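/- Let $F\subset\mathbb{R}^2_{\ge}$ be a compact convex polygon (with non-empty interior), and let $\mathcal P=\bigcup_{i=0}^{\infty} iF\cap\mathbb{N}^2$, where $iF=\{iX\mid X\in F\}$, be its semigroup; it is a submonoid of $\mathbb N^2$. Let $L_{\mathbb Q_\ge}(F)=\{\sum_{j=1}^p q_ja_j\mid p\in\mathbb N,\ q_j\in\mathbb{Q}_{\ge},\ a_j\in F\}$ be the cone generated by $F$. A ray is a line through the origin $O$; it is extremal for the cone if it contains a point of the cone other than $O$ and a sum of two elements of the cone lies on it only if both summands do. (a) The cone $L_{\mathbb Q_\ge}(F)$ has exactly two extremal rays $\tau_1\ne\tau_2$, and $\mathcal P$ is finitely generated (that is, $\mathcal P=\{\sum_j\lambda_ja_j\mid\lambda_j\in\mathbb N\}$ for some finite set $\{a_1,\dots,a_r\}\subset\mathbb{N}^2$) if and only if each of $F\cap\tau_1$ and $F\cap\tau_2$ contains a point of $\mathbb{Q}^2$ different from $O$. (b) There is one algorithm that, for every such polygon $F$ whose semigroup $\mathcal P$ is finitely generated, given the coordinates of any finite list of points with convex hull $F$ (for instance the vertices of $F$), halts and outputs a list without repetitions of the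 elements of the minimal system of generators of $\mathcal P$, that is, of a generating set no proper subset of which generates $\mathcal P$. Here an algorithm computes exactly with its real input, as a Blum--Shub--Smale machine without real constants does: on input $x\in\mathbb R^m$, a fixed Turing-computable function of $m$ and of the answers received so far determines either the next question, of the form "is $q(x)>0$?" with $q$ a polynomial in $m$ variables with integer coefficients, which is answered correctly, or the output, at which the algorithm halts. -/

import Mathlib

open scoped Pointwise

/-! ### Convex polygons in the first quadrant and their semigroups -/

/-- A compact convex polygon in `ℝ²_≥`, presented by a finite list of points of which it is the
convex hull (for instance its vertices in clockwise order). A polygon is two-dimensional, so its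
interior is not empty. -/
structure ConvexPolygon where
  points : List (ℝ × ℝ)
  nonneg : ∀ p ∈ points, 0 ≤ p.1 ∧ 0 ≤ p.2
  interior_nonempty : (interior (convexHull ℝ {p | p ∈ points})).Nonempty

/-- The point set `F ⊆ ℝ²` of a polygon. -/
def ConvexPolygon.body (F : ConvexPolygon) : Set (ℝ × ℝ) :=
  convexHull ℝ {p | p ∈ F.points}

theorem ConvexPolygon.convex_body (F : ConvexPolygon) : Convex ℝ F.body :=
  convex_convexHull ℝ _

theorem ConvexPolygon.nonempty_body (F : ConvexPolygon) : F.body.Nonempty :=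
  F.interior_nonempty.mono interior_subset

/-- For a nonempty convex `F ⊆ ℝ²`, the semigroup `⋃_{i ≥ 0} iF ∩ ℕ²`, where
`iF = {iX | X ∈ F}`. -/
def convexSemigroup (F : Set (ℝ × ℝ)) (hF : Convex ℝ F) (hne : F.Nonempty) :
    AddSubmonoid (ℕ × ℕ) where
  carrier := {n | ∃ i : ℕ, ((n.1 : ℝ), (n.2 : ℝ)) ∈ (i : ℝ) • F}
  zero_mem' := ⟨0, by simp [Set.zero_smul_set hne]⟩
  add_mem' := by
    rintro a b ⟨i, hi⟩ ⟨j, hj⟩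
    refine ⟨i + j, ?_⟩
    have h := Set.add_mem_add hi hj
    rw [← hF.add_smul (Nat.cast_nonneg i) (Nat.cast_nonneg j)] at h
    simpa using h

/-- The polygonal semigroup `𝒫` of `F`. -/
def ConvexPolygon.semigroup (F : ConvexPolygon) : AddSubmonoid (ℕ × ℕ) :=
  convexSemigroup F.body F.convex_body F.nonempty_body

/-- `B` is a minimal system of generators of `S`: it generates `S`, and no proper subset does. -/
def IsMinimalGeneratingSystem (S : AddSubmonoid (ℕ × ℕ)) (B : Set (ℕ × ℕ)) : Prop :=
  AddSubmonoid.closure B = S ∧ ∀ B' : Set (ℕ × ℕ), B' ⊂ B → AddSubmonoid.closure B' ≠ S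

/-! ### Cones and extremal rays -/

/-- The cone `{∑ qᵢ aᵢ | qᵢ ∈ ℚ_≥, aᵢ ∈ A}`. -/
def rationalCone (A : Set (ℝ × ℝ)) : Set (ℝ × ℝ) :=
  (Submodule.span ℚ≥0 A : Set (ℝ × ℝ))

/-- A ray (a line `τ` through the origin) is extremal for the cone `C` if it meets `C` outside the
origin and a sum of two elements of `C` lies on `τ` only if both summands do. -/
def IsExtremalRay (C : Set (ℝ × ℝ)) (τ : Submodule ℝ (ℝ × ℝ)) : Prop :=
  Module.finrank ℝ τ = 1 ∧ (∃ x ∈ C, x ∈ τ ∧ x ≠ 0) ∧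
    ∀ x ∈ C, ∀ y ∈ C, x + y ∈ τ → x ∈ τ ∧ y ∈ τ

/-- `A` contains a rational point other than the origin. -/
def HasNonzeroRationalPoint (A : Set (ℝ × ℝ)) : Prop :=
  ∃ a b : ℚ, (a, b) ≠ (0, 0) ∧ ((a : ℝ), (b : ℝ)) ∈ A

/-! ### Algorithms with real input

The input is a finite list of real numbers, on which the algorithm can do exact arithmetic and
exact comparisons, as on a Blum–Shub–Smale machine (real RAM) without real constants; the output
is discrete. All branchings of such a machine are on signs of polynomials with integer coefficients
in the input, so a computation is a dialogue in which the control, a Turing-computable function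
of the number of inputs and of the answers received so far, either asks for such a sign or
stops with an output. -/

/-- A polynomial with integer coefficients, as the list of its monomials: `(c, [e₀, e₁, …])`
stands for `c x₀ ^ e₀ x₁ ^ e₁ ⋯`. -/
abbrev IntPoly := List (ℤ × List ℕ)

/-- The value of a polynomial at `x = [x₀, x₁, …]`. -/
noncomputable def IntPoly.value (q : IntPoly) (x : List ℝ) : ℝ :=
  (q.map fun m => (m.1 : ℝ) * (List.zipWith (fun t e => t ^ e) x m.2).prod).sum

/-- An algorithm on finite lists of reals with outputs in `α`. From the length of the input and the
list of answers so far (the latest one first), `next` computes either the next question,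
a polynomial `q` that stands for the question whether `0 < q(x)`, or the output. -/
structure RealAlgorithm (α : Type) [Primcodable α] where
  next : ℕ × List Bool → IntPoly ⊕ α
  computable_next : Computable next

open Classical in
/-- `A.OutputsFrom x h a`: on input `x`, after the answers `h`, the algorithm stops after finitely
many further questions, and its output is `a`. -/
inductive RealAlgorithm.OutputsFrom {α : Type} [Primcodable α] (A : RealAlgorithm α)
    (x : List ℝ) : List Bool → α → Prop
  | halt (h : List Bool) (a : α) (stop_eq : A.next (x.length, h) = Sum.inr a) :
      RealAlgorithm.OutputsFrom A x h a
  | ask (h : List Bool) (a : α) (q : IntPoly) (ask_eq : A.next (x.length, h) = Sum.inl q)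
      (rest : RealAlgorithm.OutputsFrom A x (decide (0 < IntPoly.value q x) :: h) a) :
      RealAlgorithm.OutputsFrom A x h a

/-- On input `x` the algorithm halts with output `a`. -/
def RealAlgorithm.Outputs {α : Type} [Primcodable α] (A : RealAlgorithm α)
    (x : List ℝ) (a : α) : Prop :=
  A.OutputsFrom x [] a

/-- The coordinates `x₁, y₁, x₂, y₂, …` of the points that present a polygon. -/
def ConvexPolygon.coordinates (F : ConvexPolygon) : List ℝ :=
  F.points.flatMap fun p => [p.1, p.2]

/-!
If `P` is finitely generated, consider the linear form that vanishes on one of the extremal rays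
and is positive on the rest of the cone. Without a rational point on the ray it is positive on all
nonzero elements of `P`, so on `P` it dominates a positive multiple of the norm: this holds for the
finitely many generators, hence for their sums. Then it does so on the rational points of `F`,
hence on `F` by density, which fails on the ray. Conversely, rational points on the two rays give
lattice points `u`, `v` on them that lie in a common multiple `dF`. An element of `P` whose
coordinate along `u` (or `v`) exceeds a bound stays in `P` after subtraction of `u` (or `v`): it
lies in `jF` for some `j` close to its height with respect to the chord from `u / d` to `v / d`,
and the vertices of `F` off the chord, whose distance from it is bounded below by `1 / K`, can
absorb the change of height. So the elements of `P` in an explicit box generate `P`.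

The minimal generators are the indecomposable elements of `P`, and all of these lie in the box.
The data `d`, `K`, `u`, `v` are integral, and whether they have the required properties, which
lattice points of the box belong to `P`, and which of those are indecomposable is decided by signs
of integer polynomials in the coordinates. The algorithm asks for all signs in an enumeration of
the integer polynomials until the answers confirm some candidate for these data together with the
list of minimal generators.
-/

/-! ### Multiples of convex sets -/

section Convex

variable {E ι : Type*} [AddCommGroup E] [Module ℝ E] {s : Set E}

theorem sum_smul_mem_sum_smul (hs : Convex ℝ s) (hne : s.Nonempty) {T : Finset ι} {c : ι → ℝ}
    {z : ι → E} (hc : ∀ p ∈ T, 0 ≤ c p) (hz : ∀ p ∈ T, z p ∈ s) :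
    ∑ p ∈ T, c p • z p ∈ (∑ p ∈ T, c p) • s := by
  classical
  induction T using Finset.induction_on with
  | empty => simp [Set.zero_smul_set hne]
  | insert a T ha ih =>
    simp only [Finset.forall_mem_insert] at hc hz
    rw [Finset.sum_insert ha, Finset.sum_insert ha, hs.add_smul hc.1 (Finset.sum_nonneg hc.2)]
    exact Set.add_mem_add (Set.smul_mem_smul_set hz.1) (ih hc.2 hz.2)

theorem smul_add_smul_mem_smul (hs : Convex ℝ s) {x y : E} (hx : x ∈ s) (hy : y ∈ s) {a b : ℝ}
    (ha : 0 ≤ a) (hb : 0 ≤ b) : a • x + b • y ∈ (a + b) • s := by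
  rw [hs.add_smul ha hb]
  exact Set.add_mem_add (Set.smul_mem_smul_set hx) (Set.smul_mem_smul_set hy)

theorem mem_smul_of_mem_Icc (hs : Convex ℝ s) {x : E} {a b t : ℝ} (ha : 0 ≤ a) (hxa : x ∈ a • s)
    (hxb : x ∈ b • s) (ht : t ∈ Set.Icc a b) : x ∈ t • s := by
  have hb : 0 ≤ b := ha.trans (ht.1.trans ht.2)
  rw [← segment_eq_Icc (ht.1.trans ht.2)] at ht
  obtain ⟨u, v, hu, hv, huv, rfl⟩ := ht
  rw [smul_eq_mul, smul_eq_mul, hs.add_smul (mul_nonneg hu ha) (mul_nonneg hv hb), mul_smul,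
    mul_smul]
  simpa only [← add_smul, huv, one_smul] using
    Set.add_mem_add (Set.smul_mem_smul_set (a := u) hxa) (Set.smul_mem_smul_set (a := v) hxb)

theorem exists_weights_of_mem_smul_convexHull {T : Finset E} {j : ℝ} (hj : 0 ≤ j) {x : E}
    (hx : x ∈ j • convexHull ℝ (T : Set E)) :
    ∃ c : E → ℝ, (∀ p ∈ T, 0 ≤ c p) ∧ ∑ p ∈ T, c p = j ∧ ∑ p ∈ T, c p • p = x := by
  obtain ⟨z, hz, rfl⟩ := hx
  obtain ⟨c, hc, hsum, rfl⟩ := Finset.mem_convexHull'.1 hz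
  refine ⟨fun p => j * c p, fun p hp => mul_nonneg hj (hc p hp), ?_, ?_⟩
  · rw [← Finset.mul_sum, hsum, mul_one]
  · simp only [mul_smul, ← Finset.smul_sum]

end Convex

theorem exists_le_sum_mul_eq {ι : Type*} {T : Finset ι} {c l : ι → ℝ} {t : ℝ}
    (hc : ∀ p ∈ T, 0 ≤ c p) (ht : 0 ≤ t) (htc : t ≤ ∑ p ∈ T, c p * l p) :
    ∃ b : ι → ℝ, (∀ p ∈ T, 0 ≤ b p ∧ b p ≤ c p ∧ (b p ≠ 0 → 0 < l p)) ∧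
      ∑ p ∈ T, b p * l p = t := by
  classical
  set A := ∑ p ∈ T with 0 < l p, c p * l p with hA
  have htA : t ≤ A := by
    refine htc.trans ?_
    rw [hA, ← Finset.sum_filter_add_sum_filter_not T (fun p => 0 < l p)]
    refine add_le_of_nonpos_right (Finset.sum_nonpos fun p hp => ?_)
    rw [Finset.mem_filter, not_lt] at hp
    exact mul_nonpos_of_nonneg_of_nonpos (hc p hp.1) hp.2
  have hr0 : 0 ≤ t / A := div_nonneg ht (ht.trans htA)
  have hr1 : t / A ≤ 1 := div_le_one_of_le₀ htA (ht.trans htA)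
  refine ⟨fun p => if 0 < l p then t / A * c p else 0, fun p hp => ?_, ?_⟩
  · dsimp only
    split_ifs with h
    · exact ⟨mul_nonneg hr0 (hc p hp), mul_le_of_le_one_left (hc p hp) hr1, fun _ => h⟩
    · exact ⟨le_rfl, hc p hp, fun h => absurd rfl h⟩
  · simp only [ite_mul, zero_mul, ← Finset.sum_filter, mul_assoc, ← Finset.mul_sum]
    rw [← hA]
    exact div_mul_cancel_of_imp fun h => le_antisymm (h ▸ htA) ht

/-! ### Simplicial frames -/

section SimplicialFrame

variable {ι V : Type*} [Fintype ι] [AddCommGroup V] [Module ℝ V]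

/-- The linear form equal to `d` on every vector of the basis `b`. A vector `x` with nonnegative
coordinates lies in `c` times the simplex with vertices `d⁻¹ • b i` exactly for
`c = frameHeight b d x`. -/
noncomputable def frameHeight (b : Module.Basis ι ℝ V) (d : ℝ) : V →ₗ[ℝ] ℝ :=
  d • ∑ i, b.coord i

/-- The basis `b` spans the cone over the polytope with vertices in `T`, its vectors lie in the
`d`-th multiple of the polytope, and no vertex off the hyperplane `frameHeight b d = 1` through the
points `d⁻¹ • b i` is closer to it than `K⁻¹`. -/
structure IsSimplicialFrame (T : Finset V) (b : Module.Basis ι ℝ V) (d K : ℝ) : Prop where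
  one_le : 1 ≤ d
  gap_nonneg : 0 ≤ K
  basis_mem : ∀ i, b i ∈ d • convexHull ℝ (T : Set V)
  coord_nonneg : ∀ p ∈ T, ∀ i, 0 ≤ b.coord i p
  gap : ∀ p ∈ T, frameHeight b d p = 1 ∨ 1 ≤ K * |1 - frameHeight b d p|

variable {b : Module.Basis ι ℝ V} {d : ℝ}

theorem frameHeight_apply (x : V) : frameHeight b d x = d * ∑ i, b.coord i x := by
  simp [frameHeight]

theorem frameHeight_basis (i : ι) : frameHeight b d (b i) = d := by
  classical
  simp [frameHeight_apply, Module.Basis.repr_self, Finsupp.single_apply]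

theorem frameHeight_nonneg (hd : 0 ≤ d) {x : V} (hx : ∀ i, 0 ≤ b.coord i x) :
    0 ≤ frameHeight b d x := by
  rw [frameHeight_apply]
  exact mul_nonneg hd (Finset.sum_nonneg fun i _ => hx i)

theorem sum_mul_one_sub_frameHeight (T : Finset V) (a : V → ℝ) (ε : ℝ) :
    ∑ p ∈ T, a p * (ε * (1 - frameHeight b d p)) =
      ε * (∑ p ∈ T, a p - frameHeight b d (∑ p ∈ T, a p • p)) := by
  rw [map_sum, ← Finset.sum_sub_distrib, Finset.mul_sum]
  refine Finset.sum_congr rfl fun p _ => ?_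
  rw [map_smul, smul_eq_mul]
  ring

namespace IsSimplicialFrame

variable {T : Finset V} {K : ℝ} (h : IsSimplicialFrame T b d K)
include h

theorem mem_frameHeight_smul [Nonempty ι] {x : V} (hx : ∀ i, 0 ≤ b.coord i x) :
    x ∈ frameHeight b d x • convexHull ℝ (T : Set V) := by
  have hd : 0 ≤ d := zero_le_one.trans h.one_le
  choose y hy hyb using h.basis_mem
  have hx_eq : ∑ i, (d * b.coord i x) • y i = x := by
    conv_rhs => rw [← b.sum_repr x]
    refine Finset.sum_congr rfl fun i _ => ?_
    rw [mul_comm, mul_smul, b.coord_apply, show d • y i = b i from hyb i]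
  have hmem := sum_smul_mem_sum_smul (convex_convexHull ℝ (T : Set V))
    ⟨_, hy (Classical.arbitrary ι)⟩ (T := Finset.univ) (c := fun i => d * b.coord i x)
    (fun i _ => mul_nonneg hd (hx i)) fun i _ => hy i
  rwa [hx_eq, ← Finset.mul_sum, ← frameHeight_apply] at hmem

theorem coord_nonneg_of_mem_smul {j : ℝ} (hj : 0 ≤ j) {x : V}
    (hx : x ∈ j • convexHull ℝ (T : Set V)) (i : ι) : 0 ≤ b.coord i x := by
  obtain ⟨z, hz, rfl⟩ := hx
  rw [map_smul]
  exact smul_nonneg hj (convexHull_min (fun p hp => h.coord_nonneg p hp i)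
    (convex_halfSpace_ge (b.coord i).isLinear 0) hz)

/-- Rounding the height towards a given multiple that contains `x` gives another such multiple. -/
theorem exists_nat_mem_smul [Nonempty ι] {j : ℕ} {x : V}
    (hx : x ∈ (j : ℝ) • convexHull ℝ (T : Set V)) :
    ∃ i : ℕ, |(i : ℝ) - frameHeight b d x| ≤ 1 ∧ i ≤ ⌈frameHeight b d x⌉₊ ∧
      x ∈ (i : ℝ) • convexHull ℝ (T : Set V) := by
  have hcoord := h.coord_nonneg_of_mem_smul j.cast_nonneg hx
  have hheight := h.mem_frameHeight_smul hcoord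
  have hnonneg := frameHeight_nonneg (zero_le_one.trans h.one_le) hcoord
  have hconv := convex_convexHull ℝ (T : Set V)
  have hfloor := Nat.floor_le hnonneg
  have hfloor' := Nat.lt_floor_add_one (frameHeight b d x)
  have hceil := Nat.le_ceil (frameHeight b d x)
  have hceil' := Nat.ceil_lt_add_one hnonneg
  rcases le_total (j : ℝ) (frameHeight b d x) with hj | hj
  · refine ⟨⌊frameHeight b d x⌋₊, abs_le.2 ⟨by linarith, by linarith⟩, Nat.floor_le_ceil _,
      mem_smul_of_mem_Icc hconv j.cast_nonneg hx hheight ⟨?_, hfloor⟩⟩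
    exact_mod_cast Nat.le_floor hj
  · refine ⟨⌈frameHeight b d x⌉₊, abs_le.2 ⟨by linarith, by linarith⟩, le_rfl,
      mem_smul_of_mem_Icc hconv hnonneg hheight hx ⟨hceil, ?_⟩⟩
    exact_mod_cast Nat.ceil_le.2 hj

theorem frameHeight_le_mul {p : V} (hp : p ∈ T) {ε : ℝ} (hε : |ε| = 1)
    (hpos : 0 < ε * (1 - frameHeight b d p)) :
    frameHeight b d p ≤ (K + 1) * (ε * (1 - frameHeight b d p)) := by
  have habs : |1 - frameHeight b d p| = ε * (1 - frameHeight b d p) := by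
    rw [← abs_of_pos hpos, abs_mul, hε, one_mul]
  have hle := neg_abs_le (1 - frameHeight b d p)
  have hgap := (h.gap p hp).resolve_left fun h1 => hpos.ne' (by rw [h1, sub_self, mul_zero])
  rw [habs] at hgap hle
  linarith

/-- By the gap, vertices on the side of the hyperplane where `x` needs correction make up the
difference `j - frameHeight b d x` with bounded height. -/
theorem exists_summand {j : ℝ} (hj : 0 ≤ j) {x : V} (hx : x ∈ j • convexHull ℝ (T : Set V))
    (hjx : |j - frameHeight b d x| ≤ 1) :
    ∃ r : ℝ, ∃ y ∈ r • convexHull ℝ (T : Set V), 0 ≤ r ∧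
      r - frameHeight b d y = j - frameHeight b d x ∧ frameHeight b d y ≤ K + 1 ∧
      ∀ i, 0 ≤ b.coord i y ∧ b.coord i y ≤ b.coord i x := by
  obtain ⟨c, hc, hcj, hcx⟩ := exists_weights_of_mem_smul_convexHull hj hx
  obtain ⟨ε, hε, hεj⟩ : ∃ ε : ℝ, |ε| = 1 ∧
      ε * (j - frameHeight b d x) = |j - frameHeight b d x| := by
    rcases abs_cases (j - frameHeight b d x) with ⟨habs, -⟩ | ⟨habs, -⟩
    · exact ⟨1, by simp, by rw [habs, one_mul]⟩
    · exact ⟨-1, by simp, by rw [habs, neg_one_mul]⟩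
  obtain ⟨a, ha, hal⟩ := exists_le_sum_mul_eq hc (abs_nonneg (j - frameHeight b d x))
    (l := fun p => ε * (1 - frameHeight b d p))
    (by rw [sum_mul_one_sub_frameHeight, hcj, hcx, hεj])
  have hbound : ∀ p ∈ T, a p * frameHeight b d p ≤
      (K + 1) * (a p * (ε * (1 - frameHeight b d p))) := by
    intro p hp
    obtain ⟨hap, -, hpos⟩ := ha p hp
    by_cases hap0 : a p = 0
    · simp [hap0]
    · rw [mul_left_comm]
      exact mul_le_mul_of_nonneg_left (h.frameHeight_le_mul hp hε (hpos hap0)) hap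
  refine ⟨∑ p ∈ T, a p, ∑ p ∈ T, a p • p, sum_smul_mem_sum_smul (convex_convexHull ℝ _)
    (Set.smul_set_nonempty.1 ⟨x, hx⟩) (fun p hp => (ha p hp).1)
    (fun p hp => subset_convexHull ℝ _ hp), Finset.sum_nonneg fun p hp => (ha p hp).1, ?_, ?_,
    fun i => ?_⟩
  · have hε0 : ε ≠ 0 := by rintro rfl; simp at hε
    exact mul_left_cancel₀ hε0 (by rw [← sum_mul_one_sub_frameHeight, hal, hεj])
  · calc frameHeight b d (∑ p ∈ T, a p • p) = ∑ p ∈ T, a p * frameHeight b d p := by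
          simp only [map_sum, map_smul, smul_eq_mul]
      _ ≤ (K + 1) * |j - frameHeight b d x| := by
          rw [← hal, Finset.mul_sum]
          exact Finset.sum_le_sum hbound
      _ ≤ K + 1 := mul_le_of_le_one_right (by linarith [h.gap_nonneg]) hjx
  · simp only [← hcx, map_sum, map_smul, smul_eq_mul]
    exact ⟨Finset.sum_nonneg fun p hp => mul_nonneg (ha p hp).1 (h.coord_nonneg p hp i),
      Finset.sum_le_sum fun p hp => mul_le_mul_of_nonneg_right (ha p hp).2.1
        (h.coord_nonneg p hp i)⟩

theorem sub_basis_mem_smul {j : ℝ} (hj : 0 ≤ j) {x : V} (hx : x ∈ j • convexHull ℝ (T : Set V))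
    (hjx : |j - frameHeight b d x| ≤ 1) {i : ι} (hi : K + 2 ≤ b.coord i x) :
    0 ≤ j - d ∧ x - b i ∈ (j - d) • convexHull ℝ (T : Set V) := by
  classical
  obtain ⟨r, y, hy, hr, hry, hyK, hyx⟩ := h.exists_summand hj hx hjx
  have hyi : b.coord i y ≤ K + 1 := by
    have hsum : b.coord i y ≤ ∑ k, b.coord k y :=
      Finset.single_le_sum (fun k _ => (hyx k).1) (Finset.mem_univ i)
    have hmul : 1 * ∑ k, b.coord k y ≤ d * ∑ k, b.coord k y :=
      mul_le_mul_of_nonneg_right h.one_le (Finset.sum_nonneg fun k _ => (hyx k).1)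
    rw [← frameHeight_apply (d := d), one_mul] at hmul
    linarith
  have hz : ∀ k, 0 ≤ b.coord k (x - b i - y) := by
    intro k
    rw [map_sub, map_sub, Module.Basis.coord_apply b k (b i), Module.Basis.repr_self,
      Finsupp.single_apply]
    split_ifs with hik
    · subst hik
      linarith
    · linarith [(hyx k).2]
  have hheight : frameHeight b d (x - b i - y) = j - d - r := by
    rw [map_sub, map_sub, frameHeight_basis]
    linarith
  have : Nonempty ι := ⟨i⟩
  have hzmem := h.mem_frameHeight_smul hz
  have hznonneg := frameHeight_nonneg (zero_le_one.trans h.one_le) hz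
  rw [hheight] at hzmem hznonneg
  refine ⟨by linarith, ?_⟩
  have hadd := Set.add_mem_add hy hzmem
  rwa [← (convex_convexHull ℝ (T : Set V)).add_smul hr hznonneg, add_sub_cancel,
    add_sub_cancel] at hadd

end IsSimplicialFrame

end SimplicialFrame

/-! ### Polygons and their extremal rays -/

/-- The determinant `det (p, q)` of two vectors of the plane. -/
noncomputable def crossForm : ℝ × ℝ →ₗ[ℝ] ℝ × ℝ →ₗ[ℝ] ℝ :=
  LinearMap.mk₂ ℝ (fun p q => p.1 * q.2 - p.2 * q.1)
    (fun _ _ _ => by simp only [Prod.fst_add, Prod.snd_add]; ring)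
    (fun _ _ _ => by simp only [Prod.smul_fst, Prod.smul_snd, smul_eq_mul]; ring)
    (fun _ _ _ => by simp only [Prod.fst_add, Prod.snd_add]; ring)
    (fun _ _ _ => by simp only [Prod.smul_fst, Prod.smul_snd, smul_eq_mul]; ring)

theorem crossForm_apply (p q : ℝ × ℝ) : crossForm p q = p.1 * q.2 - p.2 * q.1 := rfl

@[simp]
theorem crossForm_self (p : ℝ × ℝ) : crossForm p p = 0 := by
  rw [crossForm_apply, mul_comm, sub_self]

theorem crossForm_swap (p q : ℝ × ℝ) : crossForm q p = -crossForm p q := by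
  simp only [crossForm_apply]
  ring

theorem crossForm_ne_zero {p : ℝ × ℝ} (hp : p ≠ 0) : crossForm p ≠ 0 := by
  intro h
  refine hp (Prod.ext ?_ ?_)
  · simpa [crossForm_apply] using LinearMap.congr_fun h (0, 1)
  · simpa [crossForm_apply] using LinearMap.congr_fun h (1, 0)

theorem crossForm_smul_eq (p q x : ℝ × ℝ) :
    crossForm p q • x = crossForm x q • p + crossForm p x • q := by
  ext <;> simp [crossForm_apply] <;> ring

theorem mem_span_singleton_iff_crossForm {e x : ℝ × ℝ} (he : e ≠ 0) :
    x ∈ Submodule.span ℝ {e} ↔ crossForm e x = 0 := by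
  rw [Submodule.mem_span_singleton]
  constructor
  · rintro ⟨c, rfl⟩
    rw [map_smul, crossForm_self, smul_zero]
  · intro h
    have hnorm : e.1 * e.1 + e.2 * e.2 ≠ 0 := fun h0 =>
      he (Prod.ext (mul_self_add_mul_self_eq_zero.1 h0).1 (mul_self_add_mul_self_eq_zero.1 h0).2)
    rw [crossForm_apply] at h
    refine ⟨(e.1 * x.1 + e.2 * x.2) / (e.1 * e.1 + e.2 * e.2), Prod.ext ?_ ?_⟩
    · simp only [Prod.smul_fst, smul_eq_mul]
      rw [div_mul_eq_mul_div, div_eq_iff hnorm]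
      linear_combination e.2 * h
    · simp only [Prod.smul_snd, smul_eq_mul]
      rw [div_mul_eq_mul_div, div_eq_iff hnorm]
      linear_combination -e.1 * h

theorem crossForm_nonneg_iff_slope_le {p q : ℝ × ℝ} (hp : 0 < p.1 + p.2) (hq : 0 < q.1 + q.2) :
    0 ≤ crossForm p q ↔ p.2 / (p.1 + p.2) ≤ q.2 / (q.1 + q.2) := by
  rw [div_le_div_iff₀ hp hq, crossForm_apply, ← sub_nonneg (b := p.2 * _)]
  ring_nf

theorem add_pos_of_ne_zero {p : ℝ × ℝ} (h₁ : 0 ≤ p.1) (h₂ : 0 ≤ p.2) (hp : p ≠ 0) :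
    0 < p.1 + p.2 :=
  (add_nonneg h₁ h₂).lt_of_ne' fun h => hp <|
    Prod.ext ((add_eq_zero_iff_of_nonneg h₁ h₂).1 h).1 ((add_eq_zero_iff_of_nonneg h₁ h₂).1 h).2

namespace ConvexPolygon

variable {F : ConvexPolygon}

theorem mem_body_of_mem_points {p : ℝ × ℝ} (hp : p ∈ F.points) : p ∈ F.body :=
  subset_convexHull ℝ _ hp

theorem map_nonneg_of_mem_body {f : ℝ × ℝ →ₗ[ℝ] ℝ} (hf : ∀ p ∈ F.points, 0 ≤ f p) {z : ℝ × ℝ}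
    (hz : z ∈ F.body) : 0 ≤ f z :=
  convexHull_min hf (convex_halfSpace_ge f.isLinear 0) hz

theorem fst_nonneg {z : ℝ × ℝ} (hz : z ∈ F.body) : 0 ≤ z.1 :=
  map_nonneg_of_mem_body (f := LinearMap.fst ℝ ℝ ℝ) (fun p hp => (F.nonneg p hp).1) hz

theorem snd_nonneg {z : ℝ × ℝ} (hz : z ∈ F.body) : 0 ≤ z.2 :=
  map_nonneg_of_mem_body (f := LinearMap.snd ℝ ℝ ℝ) (fun p hp => (F.nonneg p hp).2) hz

variable (F) in
theorem exists_mem_points_map_ne {f : ℝ × ℝ →ₗ[ℝ] ℝ} (hf : f ≠ 0) (c : ℝ) :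
    ∃ p ∈ F.points, f p ≠ c := by
  by_contra! h
  have hbody : f '' F.body ⊆ {c} :=
    Set.image_subset_iff.2 (convexHull_min h (convex_hyperplane f.isLinear c))
  have hopen : IsOpen (f '' interior F.body) :=
    f.isOpenMap_of_finiteDimensional (LinearMap.surjective hf) _ isOpen_interior
  exact not_isOpen_singleton c (((F.interior_nonempty.image f).subset_singleton_iff.1
    ((Set.image_mono interior_subset).trans hbody)) ▸ hopen)

/-- Two of the points that present `F` span the extremal rays of its cone, `e₁` the one closer to
the first axis. -/
structure IsExtremalPair (F : ConvexPolygon) (e₁ e₂ : ℝ × ℝ) : Prop where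
  left_mem : e₁ ∈ F.points
  right_mem : e₂ ∈ F.points
  left_nonneg : ∀ p ∈ F.points, 0 ≤ crossForm e₁ p
  right_nonneg : ∀ p ∈ F.points, 0 ≤ crossForm p e₂
  pos : 0 < crossForm e₁ e₂

variable (F) in
theorem exists_isExtremalPair : ∃ e₁ e₂, F.IsExtremalPair e₁ e₂ := by
  classical
  set T := F.points.toFinset.filter (· ≠ 0)
  have hT : ∀ p, p ∈ T ↔ p ∈ F.points ∧ p ≠ 0 := by simp [T]
  have hslope : ∀ p ∈ T, ∀ q ∈ T, 0 ≤ crossForm p q ↔ p.2 / (p.1 + p.2) ≤ q.2 / (q.1 + q.2) := by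
    simp only [hT]
    exact fun p hp q hq => crossForm_nonneg_iff_slope_le
      (add_pos_of_ne_zero (F.nonneg p hp.1).1 (F.nonneg p hp.1).2 hp.2)
      (add_pos_of_ne_zero (F.nonneg q hq.1).1 (F.nonneg q hq.1).2 hq.2)
  obtain ⟨p₀, hp₀, hne⟩ := F.exists_mem_points_map_ne
    (crossForm_ne_zero (p := (1, 0)) (by simp)) 0
  have hT₀ : T.Nonempty := ⟨p₀, (hT p₀).2 ⟨hp₀, by rintro rfl; simp at hne⟩⟩
  obtain ⟨e₁, h₁, hmin⟩ := T.exists_min_image (fun p => p.2 / (p.1 + p.2)) hT₀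
  obtain ⟨e₂, h₂, hmax⟩ := T.exists_max_image (fun p => p.2 / (p.1 + p.2)) hT₀
  have hleft : ∀ p ∈ F.points, 0 ≤ crossForm e₁ p := by
    intro p hp
    rcases eq_or_ne p 0 with rfl | hp0
    · simp
    · have hpT := (hT p).2 ⟨hp, hp0⟩
      exact (hslope e₁ h₁ p hpT).2 (hmin p hpT)
  have hright : ∀ p ∈ F.points, 0 ≤ crossForm p e₂ := by
    intro p hp
    rcases eq_or_ne p 0 with rfl | hp0
    · simp
    · have hpT := (hT p).2 ⟨hp, hp0⟩
      exact (hslope p hpT e₂ h₂).2 (hmax p hpT)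
  refine ⟨e₁, e₂, ((hT e₁).1 h₁).1, ((hT e₂).1 h₂).1, hleft, hright, not_le.1 fun hle => ?_⟩
  have hslope₂₁ := (hslope e₂ h₂ e₁ h₁).1 (by rw [crossForm_swap]; exact neg_nonneg.2 hle)
  obtain ⟨p, hp, hp0⟩ := F.exists_mem_points_map_ne (crossForm_ne_zero ((hT e₁).1 h₁).2) 0
  have hpT : p ∈ T := (hT p).2 ⟨hp, by rintro rfl; simp at hp0⟩
  have hpe₁ := (hslope p hpT e₁ h₁).2 ((hmax p hpT).trans hslope₂₁)
  rw [crossForm_swap] at hpe₁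
  exact hp0 (le_antisymm (neg_nonneg.1 hpe₁) (hleft p hp))

theorem map_nonneg_of_mem_rationalCone {f : ℝ × ℝ →ₗ[ℝ] ℝ} (hf : ∀ p ∈ F.points, 0 ≤ f p)
    {z : ℝ × ℝ} (hz : z ∈ rationalCone F.body) : 0 ≤ f z := by
  induction hz using Submodule.span_induction with
  | mem x hx => exact map_nonneg_of_mem_body hf hx
  | zero => simp
  | add x y _ _ hx hy => simpa using add_nonneg hx hy
  | smul q x _ hx =>
    rw [← NNRat.cast_smul_eq_nnqsmul ℝ, map_smul]
    exact smul_nonneg (NNRat.cast_nonneg q) hx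

end ConvexPolygon

theorem IsExtremalRay.mem_of_smul_add_smul_mem {A : Set (ℝ × ℝ)} {τ : Submodule ℝ (ℝ × ℝ)}
    (hτ : IsExtremalRay (rationalCone A) τ) (hA : Convex ℝ A) {p q : ℝ × ℝ} (hp : p ∈ A)
    (hq : q ∈ A) {a b : ℝ} (ha : 0 < a) (hb : 0 ≤ b) (h : a • p + b • q ∈ τ) : p ∈ τ := by
  obtain ⟨n, hn⟩ := exists_nat_ge (b / a)
  rw [div_le_iff₀ ha] at hn
  have hab : 0 < a + b := by linarith
  set s := (n + 1) / (a + b)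
  have hs : s * a + s * b = n + 1 := by rw [← mul_add, div_mul_cancel₀ _ hab.ne']
  have hsa : 0 ≤ s * a - 1 := by
    rw [sub_nonneg, div_mul_eq_mul_div, one_le_div hab]
    linarith
  have hsb : 0 ≤ s * b := by positivity
  have hmem := smul_add_smul_mem_smul hA hp hq hsa hsb
  rw [show s * a - 1 + s * b = n by linarith] at hmem
  obtain ⟨z, hz, hzeq : (n : ℝ) • z = _⟩ := hmem
  refine (hτ.2.2 p (Submodule.subset_span hp) ((s * a - 1) • p + (s * b) • q) ?_ ?_).1
  · rw [← hzeq, Nat.cast_smul_eq_nsmul]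
    exact nsmul_mem (Submodule.subset_span hz) n
  · convert τ.smul_mem s h using 1
    module

theorem eq_span_singleton_of_finrank_eq_one {τ : Submodule ℝ (ℝ × ℝ)}
    (hτ : Module.finrank ℝ τ = 1) {x : ℝ × ℝ} (hx : x ∈ τ) (hx0 : x ≠ 0) :
    τ = Submodule.span ℝ {x} :=
  (Submodule.eq_of_le_of_finrank_eq ((Submodule.span_singleton_le_iff_mem x τ).2 hx)
    (by rw [finrank_span_singleton hx0, hτ])).symm

namespace ConvexPolygon

variable {F : ConvexPolygon}

theorem isExtremalRay_span_singleton {e : ℝ × ℝ} (he : e ∈ F.points) (he0 : e ≠ 0)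
    {f : ℝ × ℝ →ₗ[ℝ] ℝ} (hf : ∀ p ∈ F.points, 0 ≤ f p)
    (hfe : ∀ x, x ∈ Submodule.span ℝ {e} ↔ f x = 0) :
    IsExtremalRay (rationalCone F.body) (Submodule.span ℝ {e}) := by
  refine ⟨finrank_span_singleton he0, ⟨e, Submodule.subset_span (mem_body_of_mem_points he),
    Submodule.mem_span_singleton_self e, he0⟩, fun x hx y hy hxy => ?_⟩
  rw [hfe, map_add, add_eq_zero_iff_of_nonneg (map_nonneg_of_mem_rationalCone hf hx)
    (map_nonneg_of_mem_rationalCone hf hy)] at hxy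
  rwa [hfe, hfe]

namespace IsExtremalPair

variable {e₁ e₂ : ℝ × ℝ} (h : F.IsExtremalPair e₁ e₂)
include h

theorem left_ne_zero : e₁ ≠ 0 := by
  rintro rfl
  simpa using h.pos

theorem right_ne_zero : e₂ ≠ 0 := by
  rintro rfl
  simpa using h.pos

theorem span_left_ne_span_right : Submodule.span ℝ {e₁} ≠ Submodule.span ℝ {e₂} := by
  intro heq
  have hmem := heq ▸ Submodule.mem_span_singleton_self e₂
  exact h.pos.ne' ((mem_span_singleton_iff_crossForm h.left_ne_zero).1 hmem)

theorem mem_span_left_iff {x : ℝ × ℝ} : x ∈ Submodule.span ℝ {e₁} ↔ crossForm e₁ x = 0 :=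
  mem_span_singleton_iff_crossForm h.left_ne_zero

theorem mem_span_right_iff {x : ℝ × ℝ} :
    x ∈ Submodule.span ℝ {e₂} ↔ crossForm.flip e₂ x = 0 := by
  rw [mem_span_singleton_iff_crossForm h.right_ne_zero, crossForm_swap, LinearMap.flip_apply,
    neg_eq_zero]

theorem isExtremalRay_iff (τ : Submodule ℝ (ℝ × ℝ)) :
    IsExtremalRay (rationalCone F.body) τ ↔
      τ = Submodule.span ℝ {e₁} ∨ τ = Submodule.span ℝ {e₂} := by
  have he₁ := mem_body_of_mem_points h.left_mem
  have he₂ := mem_body_of_mem_points h.right_mem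
  constructor
  · intro hτ
    obtain ⟨x, hxC, hxτ, hx0⟩ := hτ.2.1
    have ha : 0 ≤ crossForm.flip e₂ x := map_nonneg_of_mem_rationalCone h.right_nonneg hxC
    have hb : 0 ≤ crossForm e₁ x := map_nonneg_of_mem_rationalCone h.left_nonneg hxC
    have hx : crossForm x e₂ • e₁ + crossForm e₁ x • e₂ ∈ τ :=
      crossForm_smul_eq e₁ e₂ x ▸ τ.smul_mem _ hxτ
    rcases ha.eq_or_lt with ha | ha
    · rcases hb.eq_or_lt with hb | hb
      · have hx_eq := crossForm_smul_eq e₁ e₂ x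
        rw [LinearMap.flip_apply] at ha
        rw [← ha, ← hb, zero_smul, zero_smul, add_zero] at hx_eq
        exact absurd ((smul_eq_zero_iff_right h.pos.ne').1 hx_eq) hx0
      · rw [add_comm] at hx
        exact .inr (eq_span_singleton_of_finrank_eq_one hτ.1
          (hτ.mem_of_smul_add_smul_mem F.convex_body he₂ he₁ hb ha.le hx) h.right_ne_zero)
    · exact .inl (eq_span_singleton_of_finrank_eq_one hτ.1
        (hτ.mem_of_smul_add_smul_mem F.convex_body he₁ he₂ ha hb hx) h.left_ne_zero)
  · rintro (rfl | rfl)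
    · exact isExtremalRay_span_singleton h.left_mem h.left_ne_zero h.left_nonneg
        fun x => h.mem_span_left_iff
    · exact isExtremalRay_span_singleton h.right_mem h.right_ne_zero h.right_nonneg
        fun x => h.mem_span_right_iff

end IsExtremalPair

end ConvexPolygon

/-! ### Rational points on the extremal rays -/

theorem exists_forall_mem_le_mul_of_fg {M : Type*} [AddMonoid M] {S : AddSubmonoid M} (hS : S.FG)
    (f s : M →+ ℝ) (hf : ∀ x ∈ S, x ≠ 0 → 0 < f x) : ∃ C : ℝ, ∀ x ∈ S, s x ≤ C * f x := by
  obtain ⟨G, rfl⟩ := hS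
  refine ⟨∑ g ∈ G, |s g| / f g, fun x hx => ?_⟩
  have hnonneg : ∀ g ∈ G, 0 ≤ f g := by
    intro g hg
    rcases eq_or_ne g 0 with rfl | hg0
    · simp
    · exact (hf g (AddSubmonoid.subset_closure hg) hg0).le
  induction hx using AddSubmonoid.closure_induction with
  | mem g hg =>
    rcases eq_or_ne g 0 with rfl | hg0
    · simp
    calc s g ≤ |s g| / f g * f g := by
          rw [div_mul_cancel₀ _ (hf g (AddSubmonoid.subset_closure hg) hg0).ne']
          exact le_abs_self _
      _ ≤ (∑ g ∈ G, |s g| / f g) * f g := mul_le_mul_of_nonneg_right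
          (Finset.single_le_sum (f := fun g => |s g| / f g)
            (fun i hi => div_nonneg (abs_nonneg _) (hnonneg i hi)) hg) (hnonneg g hg)
  | zero => simp
  | add x y _ _ hx hy =>
    rw [map_add, map_add, mul_add]
    exact add_le_add hx hy

/-- The inclusion of `ℕ²` into `ℝ²`. -/
noncomputable def natPoint : ℕ × ℕ →+ ℝ × ℝ :=
  (Nat.castAddMonoidHom ℝ).prodMap (Nat.castAddMonoidHom ℝ)

theorem natPoint_apply (x : ℕ × ℕ) : natPoint x = ((x.1 : ℝ), (x.2 : ℝ)) := rfl

theorem natPoint_injective : Function.Injective natPoint :=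
  Nat.cast_injective.prodMap Nat.cast_injective

theorem exists_natPoint_eq_smul {a b : ℚ} (ha : 0 ≤ a) (hb : 0 ≤ b) :
    ∃ d : ℕ, 0 < d ∧ ∃ w, natPoint w = (d : ℝ) • ((a : ℝ), (b : ℝ)) := by
  lift a to ℚ≥0 using ha
  lift b to ℚ≥0 using hb
  refine ⟨a.den * b.den, Nat.mul_pos a.den_pos b.den_pos, (a.num * b.den, b.num * a.den), ?_⟩
  have ha : ((a : ℚ) : ℝ) * a.den = a.num := by exact_mod_cast NNRat.mul_den_eq_num a
  have hb : ((b : ℚ) : ℝ) * b.den = b.num := by exact_mod_cast NNRat.mul_den_eq_num b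
  rw [natPoint_apply]
  ext
  · simp only [Prod.smul_fst, smul_eq_mul, Nat.cast_mul]
    linear_combination (-(b.den : ℝ)) * ha
  · simp only [Prod.smul_snd, smul_eq_mul, Nat.cast_mul]
    linear_combination (-(a.den : ℝ)) * hb

namespace ConvexPolygon

variable {F : ConvexPolygon}

theorem mem_semigroup {x : ℕ × ℕ} :
    x ∈ F.semigroup ↔ ∃ i : ℕ, natPoint x ∈ (i : ℝ) • F.body := Iff.rfl

theorem map_natPoint_nonneg {f : ℝ × ℝ →ₗ[ℝ] ℝ} (hf : ∀ p ∈ F.points, 0 ≤ f p) {x : ℕ × ℕ}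
    (hx : x ∈ F.semigroup) : 0 ≤ f (natPoint x) := by
  obtain ⟨i, z, hz, hzx : (i : ℝ) • z = natPoint x⟩ := mem_semigroup.1 hx
  rw [← hzx, map_smul]
  exact smul_nonneg i.cast_nonneg (map_nonneg_of_mem_body hf hz)

theorem hasNonzeroRationalPoint_of_mem_semigroup {f : ℝ × ℝ →ₗ[ℝ] ℝ} {x : ℕ × ℕ}
    (hx : x ∈ F.semigroup) (hx0 : x ≠ 0) (hfx : f (natPoint x) = 0) :
    HasNonzeroRationalPoint (F.body ∩ {z | f z = 0}) := by
  obtain ⟨i, z, hz, hzx : (i : ℝ) • z = natPoint x⟩ := mem_semigroup.1 hx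
  have hi : (i : ℝ) ≠ 0 := by
    intro hi
    rw [hi, zero_smul, eq_comm] at hzx
    exact hx0 (natPoint_injective (hzx.trans (map_zero _).symm))
  have hz_eq : (((x.1 / i : ℚ) : ℝ), ((x.2 / i : ℚ) : ℝ)) = z := by
    rw [← inv_smul_smul₀ hi z, hzx, natPoint_apply]
    push_cast
    ext
    · exact div_eq_inv_mul _ _
    · exact div_eq_inv_mul _ _
  refine ⟨x.1 / i, x.2 / i, ?_, ?_, ?_⟩
  · intro h0
    rw [Prod.mk.injEq] at h0
    have hz0 : z = 0 := by rw [← hz_eq, h0.1, h0.2]; simp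
    rw [hz0, smul_zero, eq_comm] at hzx
    exact hx0 (natPoint_injective (hzx.trans (map_zero _).symm))
  · rwa [hz_eq]
  · rw [hz_eq, Set.mem_ofPred_eq]
    rw [← hzx, map_smul] at hfx
    exact (smul_eq_zero.1 hfx).resolve_left hi

/-- The rational points of the interior are dense in `F`. -/
theorem map_nonneg_of_forall_mem_semigroup {f : ℝ × ℝ →ₗ[ℝ] ℝ}
    (hf : ∀ x ∈ F.semigroup, 0 ≤ f (natPoint x)) {z : ℝ × ℝ} (hz : z ∈ F.body) : 0 ≤ f z := by
  have hcont : Continuous f := f.continuous_of_finiteDimensional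
  have hzcl : z ∈ closure (interior F.body) := by
    rw [F.convex_body.closure_interior_eq_closure_of_nonempty_interior F.interior_nonempty]
    exact subset_closure hz
  have hdense : DenseRange (Prod.map ((↑) : ℚ → ℝ) ((↑) : ℚ → ℝ)) :=
    Rat.denseRange_cast.prodMap Rat.denseRange_cast
  by_contra! hneg
  obtain ⟨⟨a, b⟩, hab_neg, hab⟩ := hdense.exists_mem_open
    ((isOpen_lt hcont continuous_const).inter isOpen_interior)
    (mem_closure_iff.1 hzcl _ (isOpen_lt hcont continuous_const) hneg)
  replace hab : ((a : ℝ), (b : ℝ)) ∈ F.body := interior_subset hab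
  obtain ⟨d, hd, w, hw⟩ := exists_natPoint_eq_smul (Rat.cast_nonneg.1 (fst_nonneg hab))
    (Rat.cast_nonneg.1 (snd_nonneg hab))
  have hfw := hf w (mem_semigroup.2 ⟨d, hw ▸ Set.smul_mem_smul_set hab⟩)
  rw [hw, map_smul, smul_eq_mul] at hfw
  exact hab_neg.not_ge (nonneg_of_mul_nonneg_right hfw (Nat.cast_pos.2 hd))

theorem hasNonzeroRationalPoint_of_fg (hfg : F.semigroup.FG) {f : ℝ × ℝ →ₗ[ℝ] ℝ}
    (hf : ∀ p ∈ F.points, 0 ≤ f p) {e : ℝ × ℝ} (he : e ∈ F.body) (he0 : e ≠ 0) (hfe : f e = 0) :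
    HasNonzeroRationalPoint (F.body ∩ {z | f z = 0}) := by
  by_contra hrat
  have hpos : ∀ x ∈ F.semigroup, x ≠ 0 → 0 < f (natPoint x) := fun x hx hx0 =>
    (map_natPoint_nonneg hf hx).lt_of_ne' fun h0 =>
      hrat (hasNonzeroRationalPoint_of_mem_semigroup hx hx0 h0)
  set s : ℝ × ℝ →ₗ[ℝ] ℝ := LinearMap.fst ℝ ℝ ℝ + LinearMap.snd ℝ ℝ ℝ
  obtain ⟨C, hC⟩ := exists_forall_mem_le_mul_of_fg hfg (f.toAddMonoidHom.comp natPoint)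
    (s.toAddMonoidHom.comp natPoint) hpos
  have hnonneg : 0 ≤ (C • f - s) e :=
    map_nonneg_of_forall_mem_semigroup (fun x hx => sub_nonneg.2 (hC x hx)) he
  have hse : 0 < s e := add_pos_of_ne_zero (fst_nonneg he) (snd_nonneg he) he0
  rw [LinearMap.sub_apply, LinearMap.smul_apply, hfe, smul_zero] at hnonneg
  linarith

end ConvexPolygon

/-! ### Lattice frames and generators -/

/-- The basis `p, q` of the plane, with the coordinates given by Cramer's rule. -/
noncomputable def crossBasis (p q : ℝ × ℝ) (h : crossForm p q ≠ 0) :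
    Module.Basis (Fin 2) ℝ (ℝ × ℝ) :=
  .ofEquivFun
    { toFun x := ![crossForm x q / crossForm p q, crossForm p x / crossForm p q]
      invFun c := c 0 • p + c 1 • q
      map_add' x y := by ext i; fin_cases i <;> simp [add_div]
      map_smul' r x := by ext i; fin_cases i <;> simp [mul_div_assoc]
      left_inv x := by
        refine smul_right_injective _ h ?_
        simp only [crossForm_smul_eq p q x, smul_add, smul_smul, Matrix.cons_val_zero,
          Matrix.cons_val_one, mul_div_cancel₀ _ h]
      right_inv c := by ext i; fin_cases i <;> simp [h] }

theorem crossBasis_coord_zero {p q : ℝ × ℝ} (h : crossForm p q ≠ 0) (x : ℝ × ℝ) :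
    (crossBasis p q h).coord 0 x = crossForm x q / crossForm p q := by
  simp [crossBasis]

theorem crossBasis_coord_one {p q : ℝ × ℝ} (h : crossForm p q ≠ 0) (x : ℝ × ℝ) :
    (crossBasis p q h).coord 1 x = crossForm p x / crossForm p q := by
  simp [crossBasis]

theorem crossBasis_apply {p q : ℝ × ℝ} (h : crossForm p q ≠ 0) : ⇑(crossBasis p q h) = ![p, q] := by
  ext i : 1
  fin_cases i <;> simp [crossBasis]

/-- A positive multiple of the signed distance of `p` from the line through `d⁻¹ • u` and
`d⁻¹ • v`. -/
noncomputable def chordOffset (d : ℕ) (u v : ℕ × ℕ) (p : ℝ × ℝ) : ℝ :=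
  crossForm (natPoint u) (natPoint v) -
    d * (crossForm p (natPoint v) + crossForm (natPoint u) p)

namespace ConvexPolygon

/-- Lattice points `u`, `v` of the `d`-th multiple of the polygon on the two extremal rays of its
cone, and an integer `K` that bounds from below the nonzero distances of the points that present
the polygon from the line through `d⁻¹ • u` and `d⁻¹ • v`. Such data are integral, so that an
algorithm can search for them. -/
structure IsLatticeFrame (F : ConvexPolygon) (d K : ℕ) (u v : ℕ × ℕ) : Prop where
  pos : 0 < d
  det_pos : 0 < crossForm (natPoint u) (natPoint v)
  left_mem : natPoint u ∈ (d : ℝ) • F.body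
  right_mem : natPoint v ∈ (d : ℝ) • F.body
  left_nonneg : ∀ p ∈ F.points, 0 ≤ crossForm (natPoint u) p
  right_nonneg : ∀ p ∈ F.points, 0 ≤ crossForm p (natPoint v)
  gap : ∀ p ∈ F.points, chordOffset d u v p = 0 ∨
    crossForm (natPoint u) (natPoint v) ≤ K * |chordOffset d u v p|

/-- A bound for the coordinates of the elements of a system of generators. -/
def boxBound (K : ℕ) (u v : ℕ × ℕ) : ℕ := (K + 2) * (u.1 + u.2 + v.1 + v.2)

/-- A bound for the least multiple of the polygon that contains a given element of the semigroup
with coordinates at most `boxBound K u v`. -/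
def indexBound (d K : ℕ) (u v : ℕ × ℕ) : ℕ := d * boxBound K u v * (u.1 + v.2)

/-- The elements of the semigroup with coordinates at most `boxBound K u v`. -/
def boxElements (F : ConvexPolygon) (K : ℕ) (u v : ℕ × ℕ) : Set (ℕ × ℕ) :=
  {x | x ∈ F.semigroup ∧ x.1 ≤ boxBound K u v ∧ x.2 ≤ boxBound K u v}

variable {F : ConvexPolygon}

theorem body_eq_convexHull_toFinset : F.body = convexHull ℝ (F.points.toFinset : Set (ℝ × ℝ)) := by
  rw [body, List.coe_toFinset]

namespace IsLatticeFrame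

variable {d K : ℕ} {u v : ℕ × ℕ} (h : F.IsLatticeFrame d K u v)
include h

theorem frameHeight_eq (x : ℝ × ℝ) :
    frameHeight (crossBasis _ _ h.det_pos.ne') d x =
      d * (crossForm x (natPoint v) + crossForm (natPoint u) x) /
        crossForm (natPoint u) (natPoint v) := by
  rw [frameHeight_apply, Fin.sum_univ_two, crossBasis_coord_zero, crossBasis_coord_one, ← add_div,
    mul_div_assoc]

theorem one_sub_frameHeight (x : ℝ × ℝ) :
    1 - frameHeight (crossBasis _ _ h.det_pos.ne') d x =
      chordOffset d u v x / crossForm (natPoint u) (natPoint v) := by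
  rw [h.frameHeight_eq, chordOffset, sub_div, div_self h.det_pos.ne']

theorem isSimplicialFrame :
    IsSimplicialFrame F.points.toFinset (crossBasis _ _ h.det_pos.ne') d K where
  one_le := mod_cast h.pos
  gap_nonneg := K.cast_nonneg
  basis_mem i := by
    rw [← body_eq_convexHull_toFinset, crossBasis_apply]
    fin_cases i
    · exact h.left_mem
    · exact h.right_mem
  coord_nonneg p hp i := by
    rw [List.mem_toFinset] at hp
    fin_cases i
    · exact (crossBasis_coord_zero _ p).symm ▸ div_nonneg (h.right_nonneg p hp) h.det_pos.le
    · exact (crossBasis_coord_one _ p).symm ▸ div_nonneg (h.left_nonneg p hp) h.det_pos.le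
  gap p hp := by
    refine (h.gap p (List.mem_toFinset.1 hp)).imp (fun h0 => ?_) fun hK => ?_
    · rw [← sub_eq_zero, ← neg_eq_zero, neg_sub, h.one_sub_frameHeight, h0, zero_div]
    · rwa [h.one_sub_frameHeight, abs_div, abs_of_pos h.det_pos, mul_div_assoc',
        one_le_div h.det_pos]

theorem exists_nat_mem_smul_body {x : ℕ × ℕ} (hx : x ∈ F.semigroup) :
    ∃ i : ℕ, |(i : ℝ) - frameHeight (crossBasis _ _ h.det_pos.ne') d (natPoint x)| ≤ 1 ∧
      i ≤ ⌈frameHeight (crossBasis _ _ h.det_pos.ne') d (natPoint x)⌉₊ ∧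
      natPoint x ∈ (i : ℝ) • F.body := by
  obtain ⟨j, hj⟩ := mem_semigroup.1 hx
  rw [body_eq_convexHull_toFinset] at hj ⊢
  exact h.isSimplicialFrame.exists_nat_mem_smul hj

theorem exists_eq_add {x : ℕ × ℕ} (hx : x ∈ F.semigroup) {i : Fin 2}
    (hi : K + 2 ≤ (crossBasis _ _ h.det_pos.ne').coord i (natPoint x)) :
    ∃ y ∈ F.semigroup, x = y + ![u, v] i := by
  obtain ⟨j, hjx, -, hj⟩ := h.exists_nat_mem_smul_body hx
  rw [body_eq_convexHull_toFinset] at hj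
  obtain ⟨hdj, hmem⟩ := h.isSimplicialFrame.sub_basis_mem_smul j.cast_nonneg hj hjx hi
  have hw : crossBasis _ _ h.det_pos.ne' i = natPoint (![u, v] i) := by
    rw [crossBasis_apply]
    fin_cases i <;> rfl
  rw [← body_eq_convexHull_toFinset, hw, ← Nat.cast_sub (by simpa using hdj)] at hmem
  have hle : ![u, v] i ≤ x := by
    obtain ⟨z, hz, hzx : ((j - d : ℕ) : ℝ) • z = _⟩ := hmem
    have hsub : 0 ≤ natPoint x - natPoint (![u, v] i) :=
      hzx ▸ smul_nonneg (j - d).cast_nonneg (show 0 ≤ z from ⟨fst_nonneg hz, snd_nonneg hz⟩)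
    exact ⟨Nat.cast_le.1 (sub_nonneg.1 hsub.1), Nat.cast_le.1 (sub_nonneg.1 hsub.2)⟩
  obtain ⟨y, rfl⟩ := exists_add_of_le hle
  rw [map_add, add_sub_cancel_left] at hmem
  exact ⟨y, mem_semigroup.2 ⟨j - d, hmem⟩, add_comm _ _⟩

theorem le_boxBound {x : ℕ × ℕ}
    (hx : ∀ i, (crossBasis _ _ h.det_pos.ne').coord i (natPoint x) ≤ K + 2) :
    x.1 ≤ boxBound K u v ∧ x.2 ≤ boxBound K u v := by
  have hle : natPoint x ≤ ((K : ℝ) + 2) • natPoint u + ((K : ℝ) + 2) • natPoint v := by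
    rw [← (crossBasis _ _ h.det_pos.ne').sum_repr (natPoint x), Fin.sum_univ_two,
      crossBasis_apply]
    exact add_le_add
      (smul_le_smul_of_nonneg_right (hx 0) ⟨u.1.cast_nonneg, u.2.cast_nonneg⟩)
      (smul_le_smul_of_nonneg_right (hx 1) ⟨v.1.cast_nonneg, v.2.cast_nonneg⟩)
  have h₁ : (x.1 : ℝ) ≤ (K + 2) * u.1 + (K + 2) * v.1 := hle.1
  have h₂ : (x.2 : ℝ) ≤ (K + 2) * u.2 + (K + 2) * v.2 := hle.2
  norm_cast at h₁ h₂
  constructor <;> rw [boxBound] <;> nlinarith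

theorem mem_boxElements (i : Fin 2) : ![u, v] i ∈ F.boxElements K u v := by
  have hle : ∀ n ≤ u.1 + u.2 + v.1 + v.2, n ≤ boxBound K u v := fun n hn =>
    hn.trans (Nat.le_mul_of_pos_left _ (by lia))
  fin_cases i
  · exact ⟨mem_semigroup.2 ⟨d, h.left_mem⟩, hle u.1 (by lia), hle u.2 (by lia)⟩
  · exact ⟨mem_semigroup.2 ⟨d, h.right_mem⟩, hle v.1 (by lia), hle v.2 (by lia)⟩

theorem vec_ne_zero (i : Fin 2) : ![u, v] i ≠ 0 := by
  intro h0
  have hdet := h.det_pos.ne'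
  fin_cases i
  · exact hdet (by rw [show u = 0 from h0, map_zero, map_zero, LinearMap.zero_apply])
  · exact hdet (by rw [show v = 0 from h0, map_zero, map_zero])

theorem closure_boxElements : AddSubmonoid.closure (F.boxElements K u v) = F.semigroup := by
  refine le_antisymm (AddSubmonoid.closure_le.2 fun x hx => hx.1) fun x hx => ?_
  induction hn : x.1 + x.2 using Nat.strong_induction_on generalizing x with
  | _ n ih =>
    by_cases hbox : ∀ i, (crossBasis _ _ h.det_pos.ne').coord i (natPoint x) ≤ K + 2
    · exact AddSubmonoid.subset_closure ⟨hx, h.le_boxBound hbox⟩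
    · push Not at hbox
      obtain ⟨i, hi⟩ := hbox
      obtain ⟨y, hy, rfl⟩ := h.exists_eq_add hx hi.le
      have hpos : 0 < (![u, v] i).1 + (![u, v] i).2 := by
        by_contra! h0
        exact h.vec_ne_zero i (Prod.ext (by simp; lia) (by simp; lia))
      refine add_mem (ih _ ?_ y hy rfl) (AddSubmonoid.subset_closure (h.mem_boxElements i))
      rw [← hn, Prod.fst_add, Prod.snd_add]
      lia

theorem fg : F.semigroup.FG := by
  refine (AddSubmonoid.fg_iff _).2 ⟨_, h.closure_boxElements, ?_⟩
  exact (Set.finite_Iic (boxBound K u v, boxBound K u v)).subset fun x hx => hx.2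

theorem exists_le_indexBound {x : ℕ × ℕ} (hx : x ∈ F.boxElements K u v) :
    ∃ i ≤ indexBound d K u v, natPoint x ∈ (i : ℝ) • F.body := by
  obtain ⟨i, -, hi, hmem⟩ := h.exists_nat_mem_smul_body hx.1
  refine ⟨i, hi.trans (Nat.ceil_le.2 ?_), hmem⟩
  have hdet : 1 ≤ crossForm (natPoint u) (natPoint v) := by
    have hpos := h.det_pos
    simp only [crossForm_apply, natPoint_apply] at hpos ⊢
    exact_mod_cast Int.add_one_le_of_lt (a := 0) (by exact_mod_cast hpos)
  have hx₁ : (x.1 : ℝ) ≤ boxBound K u v := mod_cast hx.2.1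
  have hx₂ : (x.2 : ℝ) ≤ boxBound K u v := mod_cast hx.2.2
  have hnum : crossForm (natPoint x) (natPoint v) + crossForm (natPoint u) (natPoint x) ≤
      boxBound K u v * (u.1 + v.2) := by
    simp only [crossForm_apply, natPoint_apply]
    have h₁ : (0 : ℝ) ≤ x.2 * v.1 := by positivity
    have h₂ : (0 : ℝ) ≤ u.2 * x.1 := by positivity
    nlinarith [mul_le_mul_of_nonneg_right hx₁ (v.2.cast_nonneg (α := ℝ)),
      mul_le_mul_of_nonneg_right hx₂ (u.1.cast_nonneg (α := ℝ))]
  rw [h.frameHeight_eq, indexBound, Nat.cast_mul, Nat.cast_mul, Nat.cast_add, mul_assoc]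
  refine div_le_of_le_mul₀ h.det_pos.le (by positivity) ?_
  exact (mul_le_mul_of_nonneg_left hnum d.cast_nonneg).trans
    (le_mul_of_one_le_right (by positivity) hdet)

end IsLatticeFrame

theorem exists_natPoint_mem_smul {e : ℝ × ℝ} (he : e ∈ F.body)
    (hrat : HasNonzeroRationalPoint (F.body ∩ Submodule.span ℝ {e})) :
    ∃ d : ℕ, 0 < d ∧ ∃ w, natPoint w ∈ (d : ℝ) • F.body ∧ ∃ c : ℝ, 0 < c ∧ natPoint w = c • e := by
  obtain ⟨a, b, hab0, hab, hspan⟩ := hrat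
  obtain ⟨d, hd, w, hw⟩ := exists_natPoint_eq_smul (Rat.cast_nonneg.1 (fst_nonneg hab))
    (Rat.cast_nonneg.1 (snd_nonneg hab))
  obtain ⟨t, ht : t • e = _⟩ := Submodule.mem_span_singleton.1 hspan
  have hab_pos : 0 < ((a : ℝ), (b : ℝ)).1 + ((a : ℝ), (b : ℝ)).2 :=
    add_pos_of_ne_zero (fst_nonneg hab) (snd_nonneg hab) fun h0 => hab0 (by simpa using h0)
  rw [← ht, Prod.smul_fst, Prod.smul_snd, ← smul_add, smul_eq_mul] at hab_pos
  have htpos : 0 < t := pos_of_mul_pos_left hab_pos (add_nonneg (fst_nonneg he) (snd_nonneg he))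
  refine ⟨d, hd, w, hw ▸ Set.smul_mem_smul_set hab, d * t, by positivity, ?_⟩
  rw [hw, ← ht, smul_smul]

theorem exists_nat_forall_eq_zero_or_le_mul_abs {ι : Type*} (T : Finset ι) (f : ι → ℝ) (c : ℝ) :
    ∃ K : ℕ, ∀ p ∈ T, f p = 0 ∨ c ≤ K * |f p| := by
  have hev : ∀ p ∈ T, ∀ᶠ K : ℕ in Filter.atTop, f p = 0 ∨ c ≤ K * |f p| := by
    intro p _
    rcases eq_or_ne (f p) 0 with h0 | h0
    · exact .of_forall fun _ => .inl h0
    · filter_upwards [Filter.eventually_ge_atTop ⌈c / |f p|⌉₊] with K hK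
      exact .inr ((div_le_iff₀ (abs_pos.2 h0)).1 (Nat.ceil_le.1 hK))
  exact ((Filter.eventually_all_finset T).2 hev).exists

theorem IsExtremalPair.exists_isLatticeFrame {e₁ e₂ : ℝ × ℝ} (h : F.IsExtremalPair e₁ e₂)
    (h₁ : HasNonzeroRationalPoint (F.body ∩ Submodule.span ℝ {e₁}))
    (h₂ : HasNonzeroRationalPoint (F.body ∩ Submodule.span ℝ {e₂})) :
    ∃ d K u v, F.IsLatticeFrame d K u v := by
  obtain ⟨d₁, hd₁, w₁, hw₁, c₁, hc₁, hwe₁⟩ :=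
    exists_natPoint_mem_smul (mem_body_of_mem_points h.left_mem) h₁
  obtain ⟨d₂, hd₂, w₂, hw₂, c₂, hc₂, hwe₂⟩ :=
    exists_natPoint_mem_smul (mem_body_of_mem_points h.right_mem) h₂
  have hmem : ∀ (m n : ℕ) (w : ℕ × ℕ), natPoint w ∈ (n : ℝ) • F.body →
      natPoint (m • w) ∈ ((m * n : ℕ) : ℝ) • F.body := by
    intro m n w hw
    rw [map_nsmul, ← Nat.cast_smul_eq_nsmul ℝ, Nat.cast_mul, mul_smul]
    exact Set.smul_mem_smul_set hw
  have hu : natPoint (d₂ • w₁) = (d₂ * c₁) • e₁ := by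
    rw [map_nsmul, hwe₁, ← Nat.cast_smul_eq_nsmul ℝ, smul_smul]
  have hv : natPoint (d₁ • w₂) = (d₁ * c₂) • e₂ := by
    rw [map_nsmul, hwe₂, ← Nat.cast_smul_eq_nsmul ℝ, smul_smul]
  obtain ⟨K, hK⟩ := exists_nat_forall_eq_zero_or_le_mul_abs F.points.toFinset
    (chordOffset (d₁ * d₂) (d₂ • w₁) (d₁ • w₂))
    (crossForm (natPoint (d₂ • w₁)) (natPoint (d₁ • w₂)))
  refine ⟨d₁ * d₂, K, d₂ • w₁, d₁ • w₂, Nat.mul_pos hd₁ hd₂, ?_, ?_, hmem d₁ d₂ w₂ hw₂, ?_, ?_,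
    fun p hp => hK p (List.mem_toFinset.2 hp)⟩
  · rw [hu, hv, map_smul, LinearMap.map_smul₂]
    have := h.pos
    simp only [smul_eq_mul]
    positivity
  · exact mul_comm d₂ d₁ ▸ hmem d₂ d₁ w₁ hw₁
  · intro p hp
    rw [hu, LinearMap.map_smul₂]
    exact smul_nonneg (by positivity) (h.left_nonneg p hp)
  · intro p hp
    rw [hv, map_smul]
    exact smul_nonneg (by positivity) (h.right_nonneg p hp)

theorem IsExtremalPair.hasNonzeroRationalPoint {e₁ e₂ : ℝ × ℝ} (h : F.IsExtremalPair e₁ e₂)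
    (hfg : F.semigroup.FG) : HasNonzeroRationalPoint (F.body ∩ Submodule.span ℝ {e₁}) ∧
      HasNonzeroRationalPoint (F.body ∩ Submodule.span ℝ {e₂}) := by
  have hleft : {z | crossForm e₁ z = 0} = (Submodule.span ℝ {e₁} : Set (ℝ × ℝ)) :=
    Set.ext fun _ => h.mem_span_left_iff.symm
  have hright : {z | crossForm.flip e₂ z = 0} = (Submodule.span ℝ {e₂} : Set (ℝ × ℝ)) :=
    Set.ext fun _ => h.mem_span_right_iff.symm
  constructor
  · exact hleft ▸ hasNonzeroRationalPoint_of_fg hfg h.left_nonneg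
      (mem_body_of_mem_points h.left_mem) h.left_ne_zero (crossForm_self e₁)
  · exact hright ▸ hasNonzeroRationalPoint_of_fg hfg h.right_nonneg
      (mem_body_of_mem_points h.right_mem) h.right_ne_zero (crossForm_self e₂)

theorem IsExtremalPair.fg_iff {e₁ e₂ : ℝ × ℝ} (h : F.IsExtremalPair e₁ e₂) :
    F.semigroup.FG ↔ HasNonzeroRationalPoint (F.body ∩ Submodule.span ℝ {e₁}) ∧
      HasNonzeroRationalPoint (F.body ∩ Submodule.span ℝ {e₂}) := by
  refine ⟨h.hasNonzeroRationalPoint, fun ⟨h₁, h₂⟩ => ?_⟩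
  obtain ⟨d, K, u, v, hframe⟩ := h.exists_isLatticeFrame h₁ h₂
  exact hframe.fg

theorem exists_isLatticeFrame (hfg : F.semigroup.FG) : ∃ d K u v, F.IsLatticeFrame d K u v := by
  obtain ⟨e₁, e₂, h⟩ := F.exists_isExtremalPair
  obtain ⟨h₁, h₂⟩ := h.hasNonzeroRationalPoint hfg
  exact h.exists_isLatticeFrame h₁ h₂

end ConvexPolygon

/-! ### Indecomposable elements -/

section AddIndecomposable

variable {M : Type*} [AddMonoid M] {S : AddSubmonoid M} {B : Set M}

theorem mem_of_isAddIndecomposable (hB : AddSubmonoid.closure B = S) {x : M}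
    (hx : IsAddIndecomposable id ((S : Set M) \ {0}) x) : x ∈ B := by
  subst hB
  obtain ⟨⟨hxS, hx0⟩, hx⟩ := hx
  induction hxS using AddSubmonoid.closure_induction with
  | mem x hxB => exact hxB
  | zero => exact absurd rfl hx0
  | add y z hy hz ihy ihz =>
    rcases eq_or_ne y 0 with rfl | hy0
    · rw [zero_add] at hx0 hx ⊢
      exact ihz hx hx0
    · rcases eq_or_ne z 0 with rfl | hz0
      · rw [add_zero] at hx0 hx ⊢
        exact ihy hx hx0
      · exact ((hx y ⟨hy, hy0⟩ z ⟨hz, hz0⟩ rfl).elim hy0 hz0).elim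

theorem closure_setOf_isAddIndecomposable (f : M →+ ℕ) (hf : ∀ x ∈ S, f x = 0 → x = 0) :
    AddSubmonoid.closure {x | IsAddIndecomposable id ((S : Set M) \ {0}) x} = S := by
  refine le_antisymm (AddSubmonoid.closure_le.2 fun x hx => hx.1.1) fun x hx => ?_
  induction hn : f x using Nat.strong_induction_on generalizing x with
  | _ n ih =>
    by_cases hind : IsAddIndecomposable id ((S : Set M) \ {0}) x
    · exact AddSubmonoid.subset_closure hind
    rcases eq_or_ne x 0 with rfl | hx0
    · exact zero_mem _
    obtain ⟨y, ⟨hy, hy0⟩, z, ⟨hz, hz0⟩, rfl⟩ :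
        ∃ y ∈ (S : Set M) \ {0}, ∃ z ∈ (S : Set M) \ {0}, x = y + z := by
      by_contra! hne
      exact hind ⟨⟨hx, hx0⟩, fun y hy z hz h => (hne y hy z hz h).elim⟩
    have hfy := Nat.pos_of_ne_zero fun h => hy0 (hf y hy h)
    have hfz := Nat.pos_of_ne_zero fun h => hz0 (hf z hz h)
    rw [map_add] at hn
    exact add_mem (ih (f y) (by lia) y hy rfl) (ih (f z) (by lia) z hz rfl)

theorem isAddIndecomposable_diff_zero_iff (hB : AddSubmonoid.closure B = S)
    (hdown : ∀ y ∈ S, ∀ z ∈ S, y + z ∈ B → y ∈ B ∧ z ∈ B) {x : M} :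
    IsAddIndecomposable id (B \ {0}) x ↔ IsAddIndecomposable id ((S : Set M) \ {0}) x := by
  have hBS : B ⊆ S := hB ▸ AddSubmonoid.subset_closure
  constructor
  · refine fun hx => ⟨⟨hBS hx.1.1, hx.1.2⟩, fun y hy z hz hxyz => ?_⟩
    have hyz := hdown y hy.1 z hz.1 (hxyz ▸ hx.1.1)
    exact hx.2 y ⟨hyz.1, hy.2⟩ z ⟨hyz.2, hz.2⟩ hxyz
  · exact fun hx => ⟨⟨mem_of_isAddIndecomposable hB hx, hx.1.2⟩,
      fun y hy z hz => hx.2 y ⟨hBS hy.1, hy.2⟩ z ⟨hBS hz.1, hz.2⟩⟩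

end AddIndecomposable

theorem isMinimalGeneratingSystem_setOf_isAddIndecomposable (S : AddSubmonoid (ℕ × ℕ)) :
    IsMinimalGeneratingSystem S
      {x | IsAddIndecomposable id ((S : Set (ℕ × ℕ)) \ {0}) x} := by
  refine ⟨closure_setOf_isAddIndecomposable (AddMonoidHom.fst ℕ ℕ + AddMonoidHom.snd ℕ ℕ)
    fun x _ hx => Prod.ext (Nat.add_eq_zero_iff.1 hx).1 (Nat.add_eq_zero_iff.1 hx).2,
    fun B hB hclosure => hB.2 fun x hx => mem_of_isAddIndecomposable hclosure hx⟩

theorem ConvexPolygon.IsLatticeFrame.isMinimalGeneratingSystem {F : ConvexPolygon} {d K : ℕ}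
    {u v : ℕ × ℕ} (h : F.IsLatticeFrame d K u v) :
    IsMinimalGeneratingSystem F.semigroup
      {x | IsAddIndecomposable id (F.boxElements K u v \ {0}) x} := by
  simp_rw [isAddIndecomposable_diff_zero_iff h.closure_boxElements fun _ hy _ hz hyz =>
    ⟨⟨hy, (Nat.le_add_right _ _).trans hyz.2.1, (Nat.le_add_right _ _).trans hyz.2.2⟩,
      ⟨hz, (Nat.le_add_left _ _).trans hyz.2.1, (Nat.le_add_left _ _).trans hyz.2.2⟩⟩]
  exact isMinimalGeneratingSystem_setOf_isAddIndecomposable _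

/-! ### Membership in a multiple of the polygon -/

theorem collinear_triple_of_crossForm_eq_zero {p q r : ℝ × ℝ}
    (h : crossForm (q - p) (r - p) = 0) : Collinear ℝ {p, q, r} := by
  rcases eq_or_ne q p with rfl | hqp
  · simpa using collinear_pair ℝ q r
  obtain ⟨c, hc⟩ := Submodule.mem_span_singleton.1
    ((mem_span_singleton_iff_crossForm (sub_ne_zero.2 hqp)).2 h)
  have hr : r ∈ affineSpan ℝ {p, q} := by
    convert AffineMap.lineMap_mem_affineSpan_pair c p q
    rw [AffineMap.lineMap_apply, vsub_eq_sub, vadd_eq_add, hc, sub_add_cancel]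
  have hcol := collinear_insert_of_mem_affineSpan_pair hr
  rwa [Set.insert_comm, Set.pair_comm r q] at hcol

theorem crossForm_sub_ne_zero_of_card_eq_three {p q r : ℝ × ℝ}
    (hind : AffineIndependent ℝ ((↑) : ({p, q, r} : Finset (ℝ × ℝ)) → ℝ × ℝ))
    (hcard : ({p, q, r} : Finset (ℝ × ℝ)).card = 3) : crossForm (q - p) (r - p) ≠ 0 := by
  intro h0
  have hrank := hind.finrank_vectorSpan (n := 2) (by rwa [Fintype.card_coe])
  rw [Subtype.range_coe_subtype, Finset.setOfPred_mem, Finset.coe_insert, Finset.coe_pair] at hrank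
  have hle := (collinear_triple_of_crossForm_eq_zero h0).finrank_le_one
  lia

theorem exists_subset_triple {s : Set (ℝ × ℝ)}
    (hs : ∀ e ≠ 0, ∀ c, ∃ r ∈ s, crossForm e r ≠ c) {T : Finset (ℝ × ℝ)} (hT : T.Nonempty)
    (hTs : (T : Set (ℝ × ℝ)) ⊆ s) (hind : AffineIndependent ℝ ((↑) : T → ℝ × ℝ)) :
    ∃ p ∈ s, ∃ q ∈ s, ∃ r ∈ s, crossForm (q - p) (r - p) ≠ 0 ∧ (T : Set (ℝ × ℝ)) ⊆ {p, q, r} := by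
  have hpair : ∀ p ∈ s, ∀ q ∈ s, q ≠ p → (T : Set (ℝ × ℝ)) ⊆ {p, q} →
      ∃ p ∈ s, ∃ q ∈ s, ∃ r ∈ s, crossForm (q - p) (r - p) ≠ 0 ∧ (T : Set (ℝ × ℝ)) ⊆ {p, q, r} := by
    intro p hp q hq hqp hT
    obtain ⟨r, hr, hne⟩ := hs (q - p) (sub_ne_zero.2 hqp) (crossForm (q - p) p)
    refine ⟨p, hp, q, hq, r, hr, by rwa [map_sub (crossForm (q - p)), sub_ne_zero],
      hT.trans (Set.insert_subset_insert (by simp))⟩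
  have hcard : T.card ≤ 3 := by
    have hle := hind.card_le_finrank_succ.trans (Nat.succ_le_succ (Submodule.finrank_le _))
    simpa using hle
  obtain h1 | h2 | h3 : T.card = 1 ∨ T.card = 2 ∨ T.card = 3 := by
    have := hT.card_pos
    lia
  · obtain ⟨p, rfl⟩ := Finset.card_eq_one.1 h1
    obtain ⟨q, hq, hne⟩ := hs (1, 0) (by simp) (crossForm (1, 0) p)
    exact hpair p (hTs (by simp)) q hq (fun h => hne (by rw [h])) (by simp)
  · obtain ⟨p, q, hpq, rfl⟩ := Finset.card_eq_two.1 h2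
    exact hpair p (hTs (by simp)) q (hTs (by simp)) hpq.symm (by simp)
  · obtain ⟨p, q, r, -, -, -, rfl⟩ := Finset.card_eq_three.1 h3
    exact ⟨p, hTs (by simp), q, hTs (by simp), r, hTs (by simp),
      crossForm_sub_ne_zero_of_card_eq_three hind h3, by simp⟩

theorem exists_mem_convexHull_triple {s : Set (ℝ × ℝ)}
    (hs : ∀ e ≠ 0, ∀ c, ∃ r ∈ s, crossForm e r ≠ c) {z : ℝ × ℝ} (hz : z ∈ convexHull ℝ s) :
    ∃ p ∈ s, ∃ q ∈ s, ∃ r ∈ s, 0 < crossForm (q - p) (r - p) ∧ z ∈ convexHull ℝ {p, q, r} := by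
  rw [convexHull_eq_union] at hz
  simp only [Set.mem_iUnion, exists_prop] at hz
  obtain ⟨T, hTs, hind, hzT⟩ := hz
  obtain ⟨p, hp, q, hq, r, hr, hne, hT⟩ :=
    exists_subset_triple hs (Finset.coe_nonempty.1 (convexHull_nonempty_iff.1 ⟨z, hzT⟩)) hTs hind
  replace hzT := convexHull_mono hT hzT
  rcases hne.lt_or_gt with hneg | hpos
  · refine ⟨p, hp, r, hr, q, hq, ?_, Set.pair_comm q r ▸ hzT⟩
    rwa [crossForm_swap, neg_pos]
  · exact ⟨p, hp, q, hq, r, hr, hpos, hzT⟩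

/-- The orientation of the triangle with vertices `x`, `j • p`, `j • q`, divided by `j`. The
division makes it affine in each of `p` and `q`. -/
noncomputable def scaledOrientation (j : ℝ) (x p q : ℝ × ℝ) : ℝ :=
  j * crossForm p q - crossForm p x - crossForm x q

theorem crossForm_sub_rotate (p q r : ℝ × ℝ) :
    crossForm (r - q) (p - q) = crossForm (q - p) (r - p) := by
  simp only [crossForm_apply, Prod.fst_sub, Prod.snd_sub]
  ring

theorem sum_scaledOrientation (j : ℝ) (x p q r : ℝ × ℝ) :
    scaledOrientation j x q r + scaledOrientation j x r p + scaledOrientation j x p q =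
      j * crossForm (q - p) (r - p) := by
  simp only [scaledOrientation, crossForm_apply, Prod.fst_sub, Prod.snd_sub]
  ring

theorem sum_scaledOrientation_smul (j : ℝ) (x p q r : ℝ × ℝ) :
    scaledOrientation j x q r • p + scaledOrientation j x r p • q + scaledOrientation j x p q • r =
      crossForm (q - p) (r - p) • x := by
  ext <;> simp [scaledOrientation, crossForm_apply] <;> ring

theorem mem_smul_of_scaledOrientation_nonneg {s : Set (ℝ × ℝ)} (hs : Convex ℝ s) {j : ℝ}
    (hj : 0 < j) {x p q r : ℝ × ℝ} (hp : p ∈ s) (hq : q ∈ s) (hr : r ∈ s)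
    (hpq : 0 < scaledOrientation j x p q) (hqr : 0 ≤ scaledOrientation j x q r)
    (hrp : 0 ≤ scaledOrientation j x r p) : x ∈ j • s := by
  have hsum := sum_scaledOrientation j x p q r
  have hD : 0 < crossForm (q - p) (r - p) :=
    pos_of_mul_pos_right (hsum ▸ add_pos_of_nonneg_of_pos (add_nonneg hqr hrp) hpq) hj.le
  have hmem : (scaledOrientation j x q r • p + scaledOrientation j x r p • q) +
      scaledOrientation j x p q • r ∈ ((scaledOrientation j x q r + scaledOrientation j x r p) +
        scaledOrientation j x p q) • s := by
    rw [hs.add_smul (add_nonneg hqr hrp) hpq.le]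
    exact Set.add_mem_add (smul_add_smul_mem_smul hs hp hq hqr hrp) (Set.smul_mem_smul_set hr)
  rwa [hsum, sum_scaledOrientation_smul, mul_comm, mul_smul, Set.smul_mem_smul_set_iff₀ hD.ne']
    at hmem

theorem scaledOrientation_nonneg_of_mem_smul {j : ℝ} (hj : 0 ≤ j) {x p q r : ℝ × ℝ}
    (hD : 0 ≤ crossForm (q - p) (r - p)) (hx : x ∈ j • convexHull ℝ {p, q, r}) :
    0 ≤ scaledOrientation j x p q := by
  obtain ⟨z, hz, rfl⟩ := hx
  have hscale : scaledOrientation j (j • z) p q = j * crossForm (q - p) (z - p) := by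
    simp only [scaledOrientation, crossForm_apply, Prod.fst_sub, Prod.snd_sub, Prod.smul_fst,
      Prod.smul_snd, smul_eq_mul]
    ring
  rw [hscale]
  refine mul_nonneg hj ?_
  rw [map_sub, sub_nonneg]
  refine convexHull_min ?_ (convex_halfSpace_ge (crossForm (q - p)).isLinear _) hz
  rintro w (rfl | rfl | rfl)
  · exact le_refl (crossForm (q - w) w)
  · rw [Set.mem_ofPred_eq, ← sub_nonneg, ← map_sub, crossForm_self]
  · rw [Set.mem_ofPred_eq, ← sub_nonneg, ← map_sub]
    exact hD

theorem ConvexPolygon.mem_smul_body_iff {F : ConvexPolygon} {j : ℝ} (hj : 0 < j) {x : ℝ × ℝ} :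
    x ∈ j • F.body ↔ ∃ p ∈ F.points, ∃ q ∈ F.points, ∃ r ∈ F.points,
      0 < scaledOrientation j x p q ∧ 0 ≤ scaledOrientation j x q r ∧
        0 ≤ scaledOrientation j x r p := by
  constructor
  · rintro ⟨z, hz, rfl⟩
    obtain ⟨p, hp, q, hq, r, hr, hD, hzpqr⟩ := exists_mem_convexHull_triple
      (fun e he c => F.exists_mem_points_map_ne (crossForm_ne_zero he) c) hz
    have hx := Set.smul_mem_smul_set (a := j) hzpqr
    have hpq := scaledOrientation_nonneg_of_mem_smul hj.le hD.le hx
    have hqr : 0 ≤ scaledOrientation j (j • z) q r :=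
      scaledOrientation_nonneg_of_mem_smul hj.le (r := p) (crossForm_sub_rotate p q r ▸ hD.le)
        (by rwa [Set.pair_comm r p, Set.insert_comm q p])
    have hrp : 0 ≤ scaledOrientation j (j • z) r p :=
      scaledOrientation_nonneg_of_mem_smul hj.le (r := q) (crossForm_sub_rotate r p q ▸ hD.le)
        (by rwa [Set.insert_comm r p, Set.pair_comm r q])
    have hsum := sum_scaledOrientation j (j • z) p q r ▸ mul_pos hj hD
    rcases hpq.lt_or_eq with h | hpq0
    · exact ⟨p, hp, q, hq, r, hr, h, hqr, hrp⟩
    rcases hqr.lt_or_eq with h | hqr0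
    · exact ⟨q, hq, r, hr, p, hp, h, hrp, hpq⟩
    · exact ⟨r, hr, p, hp, q, hq, by linarith, hpq, hqr⟩
  · rintro ⟨p, hp, q, hq, r, hr, hpq, hqr, hrp⟩
    exact mem_smul_of_scaledOrientation_nonneg F.convex_body hj (mem_body_of_mem_points hp)
      (mem_body_of_mem_points hq) (mem_body_of_mem_points hr) hpq hqr hrp

/-! ### Polynomials with integer coefficients as data -/

theorem primrec_natCast_int : Primrec fun n : ℕ => (n : ℤ) :=
  Primrec.encode_iff.1 (Primrec.nat_double.of_eq fun _ => rfl)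

theorem primrecPred_nonneg_int : PrimrecPred fun a : ℤ => 0 ≤ a := by
  refine (Primrec.eq.comp (Primrec.nat_bodd.comp .encode) (.const false)).of_eq ?_
  rintro (n | n)
  · change (2 * n).bodd = false ↔ _
    simp
  · change (2 * n + 1).bodd = false ↔ _
    simp

theorem primrec_natAbs_int : Primrec Int.natAbs := by
  refine (Primrec.nat_div2.comp (Primrec.succ.comp .encode)).of_eq ?_
  rintro (n | n)
  · change (2 * n + 1).div2 = n
    simp
  · change (2 * (n + 1)).div2 = n + 1
    simp

theorem primrec_neg_int : Primrec fun a : ℤ => -a := by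
  have hencode : Primrec fun a : ℤ =>
      if 0 ≤ a then Encodable.encode a - 1 else Encodable.encode a + 1 :=
    .ite primrecPred_nonneg_int (Primrec.pred.comp .encode) (Primrec.succ.comp .encode)
  refine Primrec.encode_iff.1 (hencode.of_eq ?_)
  rintro ((_ | n) | n) <;> rfl

theorem primrec_mul_int : Primrec₂ fun a b : ℤ => a * b := by
  have habs : Primrec fun p : ℤ × ℤ => ((p.1.natAbs * p.2.natAbs : ℕ) : ℤ) :=
    primrec_natCast_int.comp (Primrec.nat_mul.comp (primrec_natAbs_int.comp .fst)
      (primrec_natAbs_int.comp .snd))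
  have hfst : PrimrecPred fun p : ℤ × ℤ => 0 ≤ p.1 := primrecPred_nonneg_int.comp .fst
  have hsnd : PrimrecPred fun p : ℤ × ℤ => 0 ≤ p.2 := primrecPred_nonneg_int.comp .snd
  refine (Primrec.ite ((hfst.and hsnd).or (hfst.not.and hsnd.not)) habs
    (primrec_neg_int.comp habs)).of_eq fun ⟨a, b⟩ => ?_
  rw [← Int.natAbs_mul, Int.natCast_natAbs]
  split_ifs with h
  · exact abs_of_nonneg (mul_nonneg_iff.2 (by omega))
  · rw [abs_of_nonpos (mul_nonpos_iff.2 (by omega)), neg_neg]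

theorem primrec_list_sum : Primrec (List.sum : List ℕ → ℕ) :=
  (Primrec.list_foldr .id (.const 0)
    (Primrec.nat_add.comp (.comp .fst .snd) (.comp .snd .snd)).to₂).of_eq fun _ => rfl

namespace IntPoly

theorem prod_zipWith_pow (x : List ℝ) (e : List ℕ) :
    (List.zipWith (fun t e => t ^ e) x e).prod =
      ∏ i ∈ Finset.range x.length, x.getD i 0 ^ e.getD i 0 := by
  induction x generalizing e with
  | nil => simp
  | cons a x ih =>
    cases e with
    | nil => simp
    | cons b e => simp [Finset.prod_range_succ', ih, mul_comm]

theorem value_cons (s : ℤ × List ℕ) (p : IntPoly) (x : List ℝ) :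
    value (s :: p) x =
      s.1 * ∏ i ∈ Finset.range x.length, x.getD i 0 ^ s.2.getD i 0 + p.value x := by
  rw [value, List.map_cons, List.sum_cons, prod_zipWith_pow, value]

theorem value_append (p q : IntPoly) (x : List ℝ) :
    value (p ++ q) x = p.value x + q.value x := by
  simp [value]

theorem value_const (a : ℤ) (x : List ℝ) : value [(a, [])] x = a := by
  simp [value]

/-- The exponents of a product of two monomials. Exponents missing at the end of a list are
zero. -/
def addExponents (e e' : List ℕ) : List ℕ :=
  (List.range (e.length + e'.length)).map fun i => e.getD i 0 + e'.getD i 0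

theorem getD_addExponents (e e' : List ℕ) (i : ℕ) :
    (addExponents e e').getD i 0 = e.getD i 0 + e'.getD i 0 := by
  by_cases hi : i < e.length + e'.length
  · simp [addExponents, hi]
  · rw [List.getD_eq_default e 0 (by omega), List.getD_eq_default e' 0 (by omega),
      List.getD_eq_default _ 0 (by simpa [addExponents] using hi)]

theorem primrec_addExponents : Primrec₂ addExponents := by
  refine Primrec.list_map (Primrec.list_range.comp (Primrec.nat_add.comp
    (Primrec.list_length.comp .fst) (Primrec.list_length.comp .snd))) ?_
  exact Primrec.nat_add.comp ((Primrec.list_getD 0).comp (.comp .fst .fst) .snd)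
    ((Primrec.list_getD 0).comp (.comp .snd .fst) .snd)

/-- The product of two polynomials. -/
def mul (p q : IntPoly) : IntPoly :=
  p.flatMap fun s => q.map fun t => (s.1 * t.1, addExponents s.2 t.2)

theorem value_mul (p q : IntPoly) (x : List ℝ) : (p.mul q).value x = p.value x * q.value x := by
  have hterm (s : ℤ × List ℕ) : value (q.map fun t => (s.1 * t.1, addExponents s.2 t.2)) x =
      (s.1 * ∏ i ∈ Finset.range x.length, x.getD i 0 ^ s.2.getD i 0) * q.value x := by
    induction q with
    | nil => simp [value]
    | cons t q ih =>
      simp only [List.map_cons, value_cons, ih, getD_addExponents, pow_add,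
        Finset.prod_mul_distrib]
      push_cast
      ring
  induction p with
  | nil => simp [mul, value]
  | cons s p ih =>
    rw [mul, List.flatMap_cons, value_append, ← mul, hterm, ih, value_cons, add_mul]

theorem primrec_mul : Primrec₂ mul := by
  refine Primrec.list_flatMap .fst (Primrec.list_map (.comp .snd .fst) ?_)
  exact (primrec_mul_int.comp (.comp .fst (.comp .snd .fst)) (.comp .fst .snd)).pair
    (primrec_addExponents.comp (.comp .snd (.comp .snd .fst)) (.comp .snd .snd))

/-- The `i`-th variable, for lists with more than `i` entries. -/
def coordinate (i : ℕ) : IntPoly :=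
  [(1, (List.range (i + 1)).map fun t => if t = i then 1 else 0)]

theorem value_coordinate {i : ℕ} {x : List ℝ} (hi : i < x.length) :
    (coordinate i).value x = x.getD i 0 := by
  have hexp (t : ℕ) : ((List.range (i + 1)).map fun t => if t = i then 1 else 0).getD t 0 =
      if t = i then 1 else 0 := by
    by_cases ht : t < i + 1
    · simp [ht]
    · rw [List.getD_eq_default _ _ (by simp; omega), if_neg (by omega)]
  rw [coordinate, value_cons, Finset.prod_eq_single_of_mem i (Finset.mem_range.2 hi)]
  · simp [value]
  · intro t _ ht
    rw [hexp, if_neg ht, pow_zero]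

theorem primrec_coordinate : Primrec coordinate := by
  have hexp : Primrec fun i => (List.range (i + 1)).map fun t => if t = i then 1 else 0 :=
    Primrec.list_map (Primrec.list_range.comp .succ)
      (Primrec.ite (Primrec.eq.comp .snd .fst) (.const 1) (.const 0))
  exact Primrec.list_cons.comp ((Primrec.const 1).pair hexp) (.const [])

end IntPoly

/-! ### Algorithms that ask for all signs -/

/-- The `n`-th question of an enumeration of all integer polynomials. -/
def signQuestion (n : ℕ) : IntPoly := (Encodable.decode n).getD []

theorem signQuestion_encode (q : IntPoly) : signQuestion (Encodable.encode q) = q := by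
  rw [signQuestion, Encodable.encodek, Option.getD_some]

theorem primrec_signQuestion : Primrec signQuestion :=
  Primrec.option_getD.comp .decode (.const [])

open Classical in
/-- The answers to the first `n` questions of the enumeration on input `x`, the latest one
first. -/
noncomputable def signAnswers (x : List ℝ) : ℕ → List Bool
  | 0 => []
  | n + 1 => decide (0 < (signQuestion n).value x) :: signAnswers x n

theorem length_signAnswers (x : List ℝ) (n : ℕ) : (signAnswers x n).length = n := by
  induction n with
  | zero => rfl
  | succ n ih => rw [signAnswers, List.length_cons, ih]

theorem getElem?_reverse_signAnswers {x : List ℝ} {n z : ℕ} (hz : z < n) :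
    (signAnswers x n).reverse[z]? = some true ↔ 0 < (signQuestion z).value x := by
  induction n with
  | zero => omega
  | succ n ih =>
    rw [signAnswers, List.reverse_cons]
    rcases Nat.lt_succ_iff_lt_or_eq.1 hz with h | rfl
    · rw [List.getElem?_append_left (by simpa [length_signAnswers] using h), ih h]
    · rw [List.getElem?_append_right (by simp [length_signAnswers])]
      simp [length_signAnswers]

theorem exists_realAlgorithm_of_primrec {α : Type} [Primcodable α]
    {result : ℕ × List Bool → Option α} (hresult : Primrec result) :
    ∃ A : RealAlgorithm α, ∀ x, (∃ n, (result (x.length, signAnswers x n)).isSome) →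
      ∃ n, ∃ a ∈ result (x.length, signAnswers x n), A.Outputs x a := by
  have hnext : Primrec fun s : ℕ × List Bool =>
      ((result s).elim (Sum.inl (signQuestion s.2.length)) Sum.inr : IntPoly ⊕ α) :=
    (Primrec.option_casesOn hresult (Primrec.sumInl.comp (primrec_signQuestion.comp
      (Primrec.list_length.comp .snd))) (Primrec.sumInr.comp .snd).to₂).of_eq fun s => by
        cases result s <;> rfl
  let A : RealAlgorithm α := ⟨_, hnext.to_comp⟩
  refine ⟨A, fun x hx => ?_⟩
  classical
  obtain ⟨a, ha⟩ := Option.isSome_iff_exists.1 (Nat.find_spec hx)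
  refine ⟨Nat.find hx, a, ha, ?_⟩
  suffices h : ∀ n ≤ Nat.find hx, A.OutputsFrom x (signAnswers x n) a from h 0 (Nat.zero_le _)
  intro n hn
  induction hn using Nat.decreasingInduction with
  | self => exact .halt _ _ (by simp [A, ha])
  | of_succ n hn ih =>
    have hnone : result (x.length, signAnswers x n) = none := by
      simpa using Nat.find_min hx hn
    refine .ask _ _ (signQuestion n) (by simp [A, hnone, length_signAnswers]) ih

/-! ### Polynomial families and relations decided by signs -/

section Families

variable {ι β γ : Type*} [Primcodable β] [Primcodable γ] {input : ι → List ℝ}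

/-- The real number `f i b` is the value at the input `input i` of an integer polynomial that is
computed from `b` and the length of the input. -/
def IsIntPolynomial (input : ι → List ℝ) (f : ι → β → ℝ) : Prop :=
  ∃ q : ℕ × β → IntPoly, Primrec q ∧ ∀ i b, (q ((input i).length, b)).value (input i) = f i b

namespace IsIntPolynomial

variable {f g : ι → β → ℝ}

theorem of_eq (hf : IsIntPolynomial input f) (h : ∀ i b, f i b = g i b) :
    IsIntPolynomial input g :=
  (funext₂ h : f = g) ▸ hf

theorem intCast {a : β → ℤ} (ha : Primrec a) :
    IsIntPolynomial input fun _ b => (a b : ℝ) :=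
  ⟨fun s => [(a s.2, [])], Primrec.list_cons.comp ((ha.comp .snd).pair (.const [])) (.const []),
    fun _ _ => IntPoly.value_const _ _⟩

theorem natCast {a : β → ℕ} (ha : Primrec a) :
    IsIntPolynomial input fun _ b => (a b : ℝ) :=
  (intCast (primrec_natCast_int.comp ha)).of_eq fun _ _ => Int.cast_natCast _

theorem getD_input {k : β → ℕ} (hk : Primrec k) :
    IsIntPolynomial input fun i b => (input i).getD (k b) 0 := by
  refine ⟨fun s => if k s.2 < s.1 then IntPoly.coordinate (k s.2) else [],
    .ite (Primrec.nat_lt.comp (hk.comp .snd) .fst)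
      (IntPoly.primrec_coordinate.comp (hk.comp .snd)) (.const []), fun i b => ?_⟩
  dsimp only
  split_ifs with h
  · exact IntPoly.value_coordinate h
  · rw [List.getD_eq_default _ _ (by omega)]
    simp [IntPoly.value]

theorem add (hf : IsIntPolynomial input f) (hg : IsIntPolynomial input g) :
    IsIntPolynomial input fun i b => f i b + g i b := by
  obtain ⟨p, hp, hpf⟩ := hf
  obtain ⟨q, hq, hqg⟩ := hg
  exact ⟨fun s => p s ++ q s, Primrec.list_append.comp hp hq, fun i b => by
    rw [IntPoly.value_append, hpf, hqg]⟩

theorem mul (hf : IsIntPolynomial input f) (hg : IsIntPolynomial input g) :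
    IsIntPolynomial input fun i b => f i b * g i b := by
  obtain ⟨p, hp, hpf⟩ := hf
  obtain ⟨q, hq, hqg⟩ := hg
  exact ⟨fun s => (p s).mul (q s), IntPoly.primrec_mul.comp hp hq, fun i b => by
    rw [IntPoly.value_mul, hpf, hqg]⟩

theorem neg (hf : IsIntPolynomial input f) : IsIntPolynomial input fun i b => -f i b :=
  ((intCast (.const (-1))).mul hf).of_eq fun _ _ => by simp

theorem sub (hf : IsIntPolynomial input f) (hg : IsIntPolynomial input g) :
    IsIntPolynomial input fun i b => f i b - g i b :=
  (hf.add hg.neg).of_eq fun _ _ => (sub_eq_add_neg _ _).symm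

end IsIntPolynomial

/-- Whether `R i b` holds is computed from `b`, the length of the input `input i`, and the answers
to the first `n` questions on it, where any `n` beyond a computable bound will do. -/
def IsSignDecidable (input : ι → List ℝ) (R : ι → β → Prop) : Prop :=
  ∃ (bound : ℕ × β → ℕ) (test : (ℕ × List Bool) × β → Prop), Primrec bound ∧ PrimrecPred test ∧
    ∀ i b n, bound ((input i).length, b) ≤ n →
      (test (((input i).length, signAnswers (input i) n), b) ↔ R i b)

namespace IsSignDecidable

variable {R S : ι → β → Prop}

theorem of_iff (hR : IsSignDecidable input R) (h : ∀ i b, R i b ↔ S i b) :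
    IsSignDecidable input S :=
  (funext₂ fun i b => propext (h i b) : R = S) ▸ hR

theorem comp (hR : IsSignDecidable input R) {f : γ → β} (hf : Primrec f) :
    IsSignDecidable input fun i c => R i (f c) := by
  obtain ⟨bound, test, hbound, htest, h⟩ := hR
  exact ⟨fun s => bound (s.1, f s.2), fun s => test (s.1, f s.2),
    hbound.comp (Primrec.fst.pair (hf.comp .snd)), htest.comp (Primrec.fst.pair (hf.comp .snd)),
    fun i c n hn => h i (f c) n hn⟩

theorem of_primrecPred {p : β → Prop} (hp : PrimrecPred p) :
    IsSignDecidable input fun _ b => p b :=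
  ⟨fun _ => 0, fun s => p s.2, .const 0, hp.comp .snd, fun _ _ _ _ => Iff.rfl⟩

theorem zero_lt {f : ι → β → ℝ} (hf : IsIntPolynomial input f) :
    IsSignDecidable input fun i b => 0 < f i b := by
  obtain ⟨q, hq, hqf⟩ := hf
  refine ⟨fun s => Encodable.encode (q s) + 1,
    fun s => s.1.2.reverse[Encodable.encode (q (s.1.1, s.2))]? = some true,
    Primrec.succ.comp (Primrec.encode.comp hq), ?_, fun i b n hn => ?_⟩
  · exact Primrec.eq.comp (Primrec.list_getElem?.comp
      (Primrec.list_reverse.comp (.comp .snd .fst))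
      (Primrec.encode.comp (hq.comp ((Primrec.fst.comp .fst).pair .snd)))) (.const (some true))
  · dsimp only at hn ⊢
    rw [getElem?_reverse_signAnswers hn, signQuestion_encode, hqf]

theorem not (hR : IsSignDecidable input R) : IsSignDecidable input fun i b => ¬R i b := by
  obtain ⟨bound, test, hbound, htest, h⟩ := hR
  exact ⟨bound, fun s => ¬test s, hbound, htest.not, fun i b n hn => (h i b n hn).not⟩

theorem and (hR : IsSignDecidable input R) (hS : IsSignDecidable input S) :
    IsSignDecidable input fun i b => R i b ∧ S i b := by
  obtain ⟨bound, test, hbound, htest, h⟩ := hR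
  obtain ⟨bound', test', hbound', htest', h'⟩ := hS
  exact ⟨fun s => bound s + bound' s, fun s => test s ∧ test' s,
    Primrec.nat_add.comp hbound hbound', htest.and htest',
    fun i b n hn => and_congr (h i b n ((Nat.le_add_right _ _).trans hn))
      (h' i b n ((Nat.le_add_left _ _).trans hn))⟩

theorem or (hR : IsSignDecidable input R) (hS : IsSignDecidable input S) :
    IsSignDecidable input fun i b => R i b ∨ S i b :=
  (hR.not.and hS.not).not.of_iff fun _ _ => by tauto

theorem zero_le {f : ι → β → ℝ} (hf : IsIntPolynomial input f) :
    IsSignDecidable input fun i b => 0 ≤ f i b :=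
  (zero_lt hf.neg).not.of_iff fun _ _ => by rw [neg_pos, not_lt]

theorem exists_mem {R : ι → γ → β → Prop}
    (hR : IsSignDecidable input fun i (s : γ × β) => R i s.1 s.2) {l : ℕ × β → List γ}
    (hl : Primrec l) : IsSignDecidable input fun i b => ∃ a ∈ l ((input i).length, b), R i a b := by
  obtain ⟨bound, test, hbound, htest, h⟩ := hR
  refine ⟨fun s => ((l s).map fun a => bound (s.1, a, s.2)).sum,
    fun s => ∃ a ∈ l (s.1.1, s.2), test (s.1, a, s.2), ?_, ?_, fun i b n hn => ?_⟩
  · exact primrec_list_sum.comp (Primrec.list_map hl (hbound.comp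
      ((Primrec.fst.comp .fst).pair (Primrec.snd.pair (Primrec.snd.comp .fst)))))
  · have htest' : PrimrecRel fun (a : γ) (s : (ℕ × List Bool) × β) => test (s.1, a, s.2) :=
      htest.comp ((Primrec.fst.comp .snd).pair (Primrec.fst.pair (Primrec.snd.comp .snd)))
    exact htest'.exists_mem_list.comp
      (hl.comp ((Primrec.fst.comp .fst).pair .snd)) .id
  · refine exists_congr fun a => and_congr_right fun ha => h i (a, b) n (le_trans ?_ hn)
    exact List.le_sum_of_mem (List.mem_map_of_mem ha)

theorem forall_mem {R : ι → γ → β → Prop}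
    (hR : IsSignDecidable input fun i (s : γ × β) => R i s.1 s.2) {l : ℕ × β → List γ}
    (hl : Primrec l) : IsSignDecidable input fun i b => ∀ a ∈ l ((input i).length, b), R i a b :=
  (exists_mem (R := fun i a b => ¬R i a b) hR.not hl).not.of_iff fun _ _ => by push Not; rfl

theorem exists_realAlgorithm (hR : IsSignDecidable input R) {α : Type} [Primcodable α]
    {out : β → α} (hout : Primrec out) :
    ∃ A : RealAlgorithm α, ∀ i, (∃ b, R i b) → ∃ b, R i b ∧ A.Outputs (input i) (out b) := by
  classical
  obtain ⟨bound, test, hbound, htest, h⟩ := hR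
  -- Stage `n` tests the candidate with code `n.unpair.1`, so that each is tested again and again.
  let candidate (s : ℕ × List Bool) : Option β := Encodable.decode s.2.length.unpair.1
  have hcandidate : Primrec candidate :=
    Primrec.decode.comp (Primrec.fst.comp (Primrec.unpair.comp (Primrec.list_length.comp .snd)))
  let certified (b : β) (s : ℕ × List Bool) : Prop := bound (s.1, b) ≤ s.2.length ∧ test (s, b)
  have hcertified : PrimrecRel certified :=
    (Primrec.nat_le.comp (hbound.comp ((Primrec.fst.comp .snd).pair .fst))
      (Primrec.list_length.comp (.comp .snd .snd))).and (htest.comp (Primrec.snd.pair .fst))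
  have hresult : Primrec fun s => (candidate s).bind fun b =>
      if certified b s then some (out b) else none :=
    Primrec.option_bind hcandidate (Primrec.ite (hcertified.comp .snd .fst)
      (Primrec.option_some.comp (hout.comp .snd)) (.const none))
  obtain ⟨A, hA⟩ := exists_realAlgorithm_of_primrec hresult
  refine ⟨A, fun i ⟨b, hb⟩ => ?_⟩
  let n := Nat.pair (Encodable.encode b) (bound ((input i).length, b))
  have hn : bound ((input i).length, b) ≤ n := Nat.right_le_pair _ _
  obtain ⟨m, a, ha, hAa⟩ := hA (input i) ⟨n, by
    simp [candidate, certified, length_signAnswers, hn, (h i b n hn).2 hb, n]⟩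
  obtain ⟨c, -, hc⟩ := Option.mem_bind_iff.1 ha
  obtain ⟨⟨hle, hctest⟩, rfl⟩ : certified c _ ∧ out c = a := by simpa using hc
  rw [length_signAnswers] at hle
  exact ⟨c, (h i c m hle).1 hctest, hAa⟩

end IsSignDecidable

end Families

/-! ### Deciding geometric relations by signs -/

theorem primrec_add_natProd : Primrec₂ fun x y : ℕ × ℕ => x + y :=
  (Primrec.nat_add.comp (.comp .fst .fst) (.comp .fst .snd)).pair
    (Primrec.nat_add.comp (.comp .snd .fst) (.comp .snd .snd))

theorem primrecRel_mem_list {α : Type*} [Primcodable α] :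
    PrimrecRel fun (a : α) (l : List α) => a ∈ l :=
  (PrimrecRel.exists_mem_list (R := fun b a => b = a) Primrec.eq).swap.of_eq fun a l => by simp

namespace IsSignDecidable

variable {ι β : Type*} [Primcodable β] {input : ι → List ℝ} {R S : ι → β → Prop}

theorem iff (hR : IsSignDecidable input R) (hS : IsSignDecidable input S) :
    IsSignDecidable input fun i b => R i b ↔ S i b :=
  ((hR.and hS).or (hR.not.and hS.not)).of_iff fun _ _ => by tauto

theorem le {f g : ι → β → ℝ} (hf : IsIntPolynomial input f) (hg : IsIntPolynomial input g) :
    IsSignDecidable input fun i b => f i b ≤ g i b :=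
  (zero_le (hg.sub hf)).of_iff fun _ _ => sub_nonneg

theorem eq_zero {f : ι → β → ℝ} (hf : IsIntPolynomial input f) :
    IsSignDecidable input fun i b => f i b = 0 :=
  ((zero_le hf.neg).and (zero_le hf)).of_iff fun _ _ => by rw [neg_nonneg, le_antisymm_iff]

theorem le_mul_abs {f g : ι → β → ℝ} (hf : IsIntPolynomial input f) {K : β → ℕ} (hK : Primrec K)
    (hg : IsIntPolynomial input g) : IsSignDecidable input fun i b => f i b ≤ K b * |g i b| :=
  have hKg := (IsIntPolynomial.natCast hK).mul hg
  ((le hf hKg).or (le hf hKg.neg)).of_iff fun i b => by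
    rw [← le_abs, abs_mul, Nat.abs_cast]

theorem isAddIndecomposable {T : ι → β → Set (ℕ × ℕ)}
    (hT : IsSignDecidable input fun i (s : (ℕ × ℕ) × β) => s.1 ∈ T i s.2)
    {l : β → List (ℕ × ℕ)} (hl : Primrec l) (hTl : ∀ i b, ∀ x ∈ T i b, x ∈ l b) :
    IsSignDecidable input fun i (s : (ℕ × ℕ) × β) => IsAddIndecomposable id (T i s.2) s.1 := by
  let decomposes (z y x : ℕ × ℕ) : Prop := x = y + z ∧ y ≠ 0 ∧ z ≠ 0
  have hdecomposes : PrimrecPred fun s : (ℕ × ℕ) × (ℕ × ℕ) × (ℕ × ℕ) × β =>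
      decomposes s.1 s.2.1 s.2.2.1 :=
    (Primrec.eq.comp (.comp .fst (.comp .snd .snd))
      (primrec_add_natProd.comp (.comp .fst .snd) .fst)).and
      ((Primrec.eq.comp (.comp .fst .snd) (.const 0)).not.and
        (Primrec.eq.comp .fst (.const 0)).not)
  have hz := exists_mem (R := fun i z (s : (ℕ × ℕ) × (ℕ × ℕ) × β) =>
      z ∈ T i s.2.2 ∧ decomposes z s.1 s.2.1) (l := fun s => l s.2.2.2)
    ((hT.comp (.pair .fst (.comp .snd (.comp .snd .snd)))).and (of_primrecPred hdecomposes))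
    (hl.comp (.comp .snd (.comp .snd .snd)))
  have hyz := exists_mem (R := fun i y (s : (ℕ × ℕ) × β) =>
      y ∈ T i s.2 ∧ ∃ z ∈ l s.2, z ∈ T i s.2 ∧ decomposes z y s.1) (l := fun s => l s.2.2)
    ((hT.comp (.pair .fst (.comp .snd .snd))).and hz) (hl.comp (.comp .snd .snd))
  refine (hT.and hyz.not).of_iff fun i s => and_congr_right fun _ => ?_
  simp only [decomposes, id]
  push Not
  exact ⟨fun h y hy z hz hyz =>
      or_iff_not_imp_left.2 (h y (hTl _ _ y hy) hy z (hTl _ _ z hz) hz hyz),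
    fun h y _ hy z _ hz hyz => or_iff_not_imp_left.1 (h y hy z hz hyz)⟩

end IsSignDecidable

section Points

variable {ι β : Type*} [Primcodable β] {input : ι → List ℝ} {p q : ι → β → ℝ × ℝ}

/-- Both coordinates of the point `p i b` are integer polynomials in the input. -/
def IsIntPolynomialPoint (input : ι → List ℝ) (p : ι → β → ℝ × ℝ) : Prop :=
  IsIntPolynomial input (fun i b => (p i b).1) ∧ IsIntPolynomial input fun i b => (p i b).2

namespace IsIntPolynomialPoint

theorem natPoint {x : β → ℕ × ℕ} (hx : Primrec x) :
    IsIntPolynomialPoint input fun _ b => natPoint (x b) :=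
  ⟨.natCast (.comp .fst hx), .natCast (.comp .snd hx)⟩

theorem crossForm (hp : IsIntPolynomialPoint input p) (hq : IsIntPolynomialPoint input q) :
    IsIntPolynomial input fun i b => crossForm (p i b) (q i b) :=
  ((hp.1.mul hq.2).sub (hp.2.mul hq.1)).of_eq fun _ _ => (crossForm_apply _ _).symm

theorem chordOffset {d : β → ℕ} {u v : β → ℕ × ℕ} (hd : Primrec d) (hu : Primrec u)
    (hv : Primrec v) (hp : IsIntPolynomialPoint input p) :
    IsIntPolynomial input fun i b => chordOffset (d b) (u b) (v b) (p i b) :=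
  ((natPoint hu).crossForm (natPoint hv)).sub ((IsIntPolynomial.natCast hd).mul
    ((hp.crossForm (natPoint hv)).add ((natPoint hu).crossForm hp)))

theorem scaledOrientation {j : β → ℕ} {x : β → ℕ × ℕ} (hj : Primrec j) (hx : Primrec x)
    (hp : IsIntPolynomialPoint input p) (hq : IsIntPolynomialPoint input q) :
    IsIntPolynomial input fun i b =>
      scaledOrientation (j b) (_root_.natPoint (x b)) (p i b) (q i b) :=
  (((IsIntPolynomial.natCast hj).mul (hp.crossForm hq)).sub (hp.crossForm (natPoint hx))).sub
    ((natPoint hx).crossForm hq)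

end IsIntPolynomialPoint

end Points

namespace ConvexPolygon

variable {β : Type*} [Primcodable β]

theorem length_coordinates (F : ConvexPolygon) :
    F.coordinates.length = 2 * F.points.length := by
  simp [coordinates, List.length_flatMap, mul_comm]

theorem coordinates_getD (F : ConvexPolygon) (k : ℕ) :
    F.coordinates.getD (2 * k) 0 = (F.points.getD k 0).1 ∧
      F.coordinates.getD (2 * k + 1) 0 = (F.points.getD k 0).2 := by
  rw [coordinates]
  induction F.points generalizing k with
  | nil => simp
  | cons p l ih =>
    cases k with
    | zero => simp
    | succ k => simpa [mul_add] using ih k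

theorem isIntPolynomialPoint_getD {k : β → ℕ} (hk : Primrec k) :
    IsIntPolynomialPoint coordinates fun F b => F.points.getD (k b) 0 :=
  have h2k := Primrec.nat_double.comp hk
  ⟨(IsIntPolynomial.getD_input h2k).of_eq fun F b => (F.coordinates_getD (k b)).1,
    (IsIntPolynomial.getD_input (Primrec.succ.comp h2k)).of_eq fun F b =>
      (F.coordinates_getD (k b)).2⟩

theorem mem_points_iff (F : ConvexPolygon) (p : ℝ × ℝ) :
    p ∈ F.points ↔ ∃ k ∈ List.range (F.coordinates.length / 2), F.points.getD k 0 = p := by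
  rw [length_coordinates, Nat.mul_div_cancel_left _ two_pos, List.mem_iff_getElem]
  simp only [List.mem_range]
  exact exists_congr fun k => ⟨fun ⟨hk, h⟩ => ⟨hk, by rwa [List.getD_eq_getElem _ _ hk]⟩,
    fun ⟨hk, h⟩ => ⟨hk, by rwa [List.getD_eq_getElem _ _ hk] at h⟩⟩

theorem isSignDecidable_exists_mem_points {R : ConvexPolygon → ℝ × ℝ → β → Prop}
    (hR : IsSignDecidable coordinates fun F (s : ℕ × β) => R F (F.points.getD s.1 0) s.2) :
    IsSignDecidable coordinates fun F b => ∃ p ∈ F.points, R F p b :=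
  (IsSignDecidable.exists_mem (R := fun F k b => R F (F.points.getD k 0) b) hR
    (l := fun s => List.range (s.1 / 2))
    (Primrec.list_range.comp (Primrec.nat_div.comp .fst (.const 2)))).of_iff fun F b => by
      simp only [mem_points_iff, exists_exists_and_eq_and]

theorem isSignDecidable_forall_mem_points {R : ConvexPolygon → ℝ × ℝ → β → Prop}
    (hR : IsSignDecidable coordinates fun F (s : ℕ × β) => R F (F.points.getD s.1 0) s.2) :
    IsSignDecidable coordinates fun F b => ∀ p ∈ F.points, R F p b :=
  (isSignDecidable_exists_mem_points (R := fun F p b => ¬R F p b) hR.not).not.of_iff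
    fun _ _ => by push Not; rfl

theorem isSignDecidable_mem_smul_body {j : β → ℕ} {x : β → ℕ × ℕ} (hj : Primrec j)
    (hx : Primrec x) :
    IsSignDecidable coordinates fun F b => natPoint (x b) ∈ (j b : ℝ) • F.body := by
  have hzero : PrimrecPred fun b => j b = 0 ∧ x b = 0 :=
    (Primrec.eq.comp hj (.const 0)).and (Primrec.eq.comp hx (.const 0))
  have hpos : PrimrecPred fun b => 0 < j b := Primrec.nat_lt.comp (.const 0) hj
  have horient {k l : ℕ × ℕ × ℕ × β → ℕ} (hk : Primrec k) (hl : Primrec l) :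
      IsIntPolynomial coordinates fun F s => scaledOrientation (j s.2.2.2) (natPoint (x s.2.2.2))
        (F.points.getD (k s) 0) (F.points.getD (l s) 0) :=
    IsIntPolynomialPoint.scaledOrientation (hj.comp (.comp .snd (.comp .snd .snd)))
      (hx.comp (.comp .snd (.comp .snd .snd))) (isIntPolynomialPoint_getD hk)
      (isIntPolynomialPoint_getD hl)
  have htriangle : IsSignDecidable coordinates fun F b => ∃ p ∈ F.points, ∃ q ∈ F.points,
      ∃ r ∈ F.points, 0 < scaledOrientation (j b) (natPoint (x b)) p q ∧
        0 ≤ scaledOrientation (j b) (natPoint (x b)) q r ∧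
        0 ≤ scaledOrientation (j b) (natPoint (x b)) r p :=
    isSignDecidable_exists_mem_points (isSignDecidable_exists_mem_points
      (R := fun F q (s : ℕ × β) => ∃ r ∈ F.points,
        0 < scaledOrientation (j s.2) (natPoint (x s.2)) (F.points.getD s.1 0) q ∧
        0 ≤ scaledOrientation (j s.2) (natPoint (x s.2)) q r ∧
        0 ≤ scaledOrientation (j s.2) (natPoint (x s.2)) r (F.points.getD s.1 0))
      (isSignDecidable_exists_mem_points
        (R := fun F r (s : ℕ × ℕ × β) =>
          0 < scaledOrientation (j s.2.2) (natPoint (x s.2.2)) (F.points.getD s.2.1 0)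
            (F.points.getD s.1 0) ∧
          0 ≤ scaledOrientation (j s.2.2) (natPoint (x s.2.2)) (F.points.getD s.1 0) r ∧
          0 ≤ scaledOrientation (j s.2.2) (natPoint (x s.2.2)) r (F.points.getD s.2.1 0))
        ((IsSignDecidable.zero_lt (horient (.comp .fst (.comp .snd .snd)) (.comp .fst .snd))).and
          ((IsSignDecidable.zero_le (horient (.comp .fst .snd) .fst)).and
            (IsSignDecidable.zero_le (horient .fst (.comp .fst (.comp .snd .snd))))))))
  refine ((IsSignDecidable.of_primrecPred hzero).or
    ((IsSignDecidable.of_primrecPred hpos).and htriangle)).of_iff fun F b => ?_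
  rcases (j b).eq_zero_or_pos with h | h
  · simp [h, Set.zero_smul_set F.nonempty_body, map_eq_zero_iff natPoint natPoint_injective]
  · simp [h, h.ne', mem_smul_body_iff (Nat.cast_pos.2 h)]

theorem isSignDecidable_isLatticeFrame {d K : β → ℕ} {u v : β → ℕ × ℕ} (hd : Primrec d)
    (hK : Primrec K) (hu : Primrec u) (hv : Primrec v) :
    IsSignDecidable coordinates fun F b => F.IsLatticeFrame (d b) (K b) (u b) (v b) := by
  have hD {γ : Type _} [Primcodable γ] {f : γ → β} (hf : Primrec f) :
      IsIntPolynomial coordinates fun _ s => crossForm (natPoint (u (f s))) (natPoint (v (f s))) :=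
    (IsIntPolynomialPoint.natPoint (hu.comp hf)).crossForm (.natPoint (hv.comp hf))
  have hpoint : IsIntPolynomialPoint coordinates fun F (s : ℕ × β) => F.points.getD s.1 0 :=
    isIntPolynomialPoint_getD .fst
  have hleft := isSignDecidable_forall_mem_points
    (R := fun _ p b => 0 ≤ crossForm (natPoint (u b)) p)
    (.zero_le (IsIntPolynomialPoint.crossForm (.natPoint (hu.comp .snd)) hpoint))
  have hright := isSignDecidable_forall_mem_points
    (R := fun _ p b => 0 ≤ crossForm p (natPoint (v b)))
    (.zero_le (hpoint.crossForm (.natPoint (hv.comp .snd))))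
  have hoffset := hpoint.chordOffset (hd.comp .snd) (hu.comp .snd) (hv.comp .snd)
  have hgap := isSignDecidable_forall_mem_points
    (R := fun _ p b => chordOffset (d b) (u b) (v b) p = 0 ∨
      crossForm (natPoint (u b)) (natPoint (v b)) ≤ K b * |chordOffset (d b) (u b) (v b) p|)
    ((IsSignDecidable.eq_zero hoffset).or (.le_mul_abs (hD .snd) (hK.comp .snd) hoffset))
  exact ((IsSignDecidable.of_primrecPred (Primrec.nat_lt.comp (.const 0) hd)).and
    ((IsSignDecidable.zero_lt (hD .id)).and ((isSignDecidable_mem_smul_body hd hu).and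
      ((isSignDecidable_mem_smul_body hd hv).and (hleft.and (hright.and hgap)))))).of_iff
    fun F b => ⟨fun ⟨h₁, h₂, h₃, h₄, h₅, h₆, h₇⟩ => ⟨h₁, h₂, h₃, h₄, h₅, h₆, h₇⟩,
      fun ⟨h₁, h₂, h₃, h₄, h₅, h₆, h₇⟩ => ⟨h₁, h₂, h₃, h₄, h₅, h₆, h₇⟩⟩

theorem primrec_boxBound {K : β → ℕ} {u v : β → ℕ × ℕ} (hK : Primrec K) (hu : Primrec u)
    (hv : Primrec v) : Primrec fun b => boxBound (K b) (u b) (v b) :=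
  Primrec.nat_mul.comp (Primrec.nat_add.comp hK (.const 2)) (Primrec.nat_add.comp
    (Primrec.nat_add.comp (Primrec.nat_add.comp (.comp .fst hu) (.comp .snd hu)) (.comp .fst hv))
    (.comp .snd hv))

theorem primrec_indexBound {d K : β → ℕ} {u v : β → ℕ × ℕ} (hd : Primrec d) (hK : Primrec K)
    (hu : Primrec u) (hv : Primrec v) :
    Primrec fun b => indexBound (d b) (K b) (u b) (v b) :=
  Primrec.nat_mul.comp (Primrec.nat_mul.comp hd (primrec_boxBound hK hu hv))
    (Primrec.nat_add.comp (.comp .fst hu) (.comp .snd hv))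

theorem isSignDecidable_mem_boxElements {d K : β → ℕ} {u v x : β → ℕ × ℕ} (hd : Primrec d)
    (hK : Primrec K) (hu : Primrec u) (hv : Primrec v) (hx : Primrec x) :
    IsSignDecidable coordinates fun F b =>
      F.IsLatticeFrame (d b) (K b) (u b) (v b) ∧ x b ∈ F.boxElements (K b) (u b) (v b) := by
  have hbox : PrimrecPred fun b => (x b).1 ≤ boxBound (K b) (u b) (v b) ∧
      (x b).2 ≤ boxBound (K b) (u b) (v b) :=
    (Primrec.nat_le.comp (.comp .fst hx) (primrec_boxBound hK hu hv)).and
      (Primrec.nat_le.comp (.comp .snd hx) (primrec_boxBound hK hu hv))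
  have hindex := IsSignDecidable.exists_mem
    (R := fun (F : ConvexPolygon) (i : ℕ) b => natPoint (x b) ∈ (i : ℝ) • F.body)
    (isSignDecidable_mem_smul_body .fst (hx.comp .snd))
    (l := fun s => List.range (indexBound (d s.2) (K s.2) (u s.2) (v s.2) + 1))
    (Primrec.list_range.comp (Primrec.succ.comp ((primrec_indexBound hd hK hu hv).comp .snd)))
  refine ((isSignDecidable_isLatticeFrame hd hK hu hv).and
    ((IsSignDecidable.of_primrecPred hbox).and hindex)).of_iff fun F b =>
      and_congr_right fun hF => ?_
  simp only [List.mem_range, Nat.lt_succ_iff]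
  exact ⟨fun ⟨hxB, i, _, hi⟩ => ⟨mem_semigroup.2 ⟨i, hi⟩, hxB⟩,
    fun hxF => ⟨hxF.2, hF.exists_le_indexBound hxF⟩⟩

/-- The list of lattice points in the box that contains `F.boxElements K u v`. -/
def boxList (K : ℕ) (u v : ℕ × ℕ) : List (ℕ × ℕ) :=
  List.range (boxBound K u v + 1) ×ˢ List.range (boxBound K u v + 1)

theorem mem_boxList {K : ℕ} {u v x : ℕ × ℕ} :
    x ∈ boxList K u v ↔ x.1 ≤ boxBound K u v ∧ x.2 ≤ boxBound K u v := by
  rw [boxList, List.mem_product, List.mem_range, List.mem_range, Nat.lt_succ_iff, Nat.lt_succ_iff]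

theorem nodup_boxList (K : ℕ) (u v : ℕ × ℕ) : (boxList K u v).Nodup :=
  List.nodup_range.product List.nodup_range

theorem primrec_boxList {K : β → ℕ} {u v : β → ℕ × ℕ} (hK : Primrec K) (hu : Primrec u)
    (hv : Primrec v) : Primrec fun b => boxList (K b) (u b) (v b) :=
  have hrange : Primrec fun b => List.range (boxBound (K b) (u b) (v b) + 1) :=
    Primrec.list_range.comp (Primrec.succ.comp (primrec_boxBound hK hu hv))
  Primrec.list_flatMap hrange (Primrec.list_map (hrange.comp .fst)
    (Primrec.pair (.comp .snd .fst) .snd))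

/-- A lattice frame `d`, `K`, `u`, `v` together with a list `L` whose elements in the box are the
minimal generators. This is what the algorithm searches for. -/
def IsCertificate (F : ConvexPolygon) (d K : ℕ) (u v : ℕ × ℕ) (L : List (ℕ × ℕ)) : Prop :=
  F.IsLatticeFrame d K u v ∧ ∀ x ∈ boxList K u v,
    x ∈ L ↔ IsAddIndecomposable id (F.boxElements K u v \ {0}) x

theorem IsLatticeFrame.exists_isCertificate {F : ConvexPolygon} {d K : ℕ} {u v : ℕ × ℕ}
    (hF : F.IsLatticeFrame d K u v) : ∃ L, F.IsCertificate d K u v L := by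
  classical
  exact ⟨(boxList K u v).filter fun x => IsAddIndecomposable id (F.boxElements K u v \ {0}) x, hF,
    fun x hx => by simp [hx]⟩

theorem IsCertificate.isMinimalGeneratingSystem {F : ConvexPolygon} {d K : ℕ} {u v : ℕ × ℕ}
    {L : List (ℕ × ℕ)} (h : F.IsCertificate d K u v L) :
    IsMinimalGeneratingSystem F.semigroup {g | g ∈ (boxList K u v).filter (· ∈ L)} := by
  convert h.1.isMinimalGeneratingSystem using 1
  ext x
  simp only [Set.mem_ofPred_eq, List.mem_filter, decide_eq_true_eq]
  exact ⟨fun hx => (h.2 x hx.1).1 hx.2, fun hx =>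
    have hxbox := mem_boxList.2 hx.1.1.2
    ⟨hxbox, (h.2 x hxbox).2 hx⟩⟩

theorem isSignDecidable_isCertificate :
    IsSignDecidable coordinates fun F (c : ℕ × ℕ × (ℕ × ℕ) × (ℕ × ℕ) × List (ℕ × ℕ)) =>
      F.IsCertificate c.1 c.2.1 c.2.2.1 c.2.2.2.1 c.2.2.2.2 := by
  let γ := ℕ × ℕ × (ℕ × ℕ) × (ℕ × ℕ) × List (ℕ × ℕ)
  have hd : Primrec fun c : γ => c.1 := .fst
  have hK : Primrec fun c : γ => c.2.1 := .comp .fst .snd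
  have hu : Primrec fun c : γ => c.2.2.1 := .comp .fst (.comp .snd .snd)
  have hv : Primrec fun c : γ => c.2.2.2.1 := .comp .fst (.comp .snd (.comp .snd .snd))
  have hL : Primrec fun c : γ => c.2.2.2.2 := .comp .snd (.comp .snd (.comp .snd .snd))
  have hbox := primrec_boxList hK hu hv
  have helements := (isSignDecidable_mem_boxElements (hd.comp .snd) (hK.comp .snd) (hu.comp .snd)
    (hv.comp .snd) .fst).and (.of_primrecPred (Primrec.eq.comp .fst (.const 0)).not)
  let T (F : ConvexPolygon) (c : γ) : Set (ℕ × ℕ) :=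
    {x | (F.IsLatticeFrame c.1 c.2.1 c.2.2.1 c.2.2.2.1 ∧
      x ∈ F.boxElements c.2.1 c.2.2.1 c.2.2.2.1) ∧ x ≠ 0}
  have hindecomposable := IsSignDecidable.isAddIndecomposable (T := T) helements hbox
    fun F c x hx => mem_boxList.2 hx.1.2.2
  have hmem : PrimrecPred fun s : (ℕ × ℕ) × γ => s.1 ∈ s.2.2.2.2.2 :=
    primrecRel_mem_list.comp .fst (hL.comp .snd)
  refine ((isSignDecidable_isLatticeFrame hd hK hu hv).and (.forall_mem
    (R := fun F x (c : γ) => x ∈ c.2.2.2.2 ↔ IsAddIndecomposable id (T F c) x)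
    ((IsSignDecidable.of_primrecPred hmem).iff hindecomposable)
    (hbox.comp .snd))).of_iff fun F c => and_congr_right fun hF => ?_
  simp only [T, hF, true_and]
  rfl

theorem exists_realAlgorithm_isMinimalGeneratingSystem :
    ∃ A : RealAlgorithm (List (ℕ × ℕ)), ∀ F : ConvexPolygon, F.semigroup.FG →
      ∃ L : List (ℕ × ℕ), A.Outputs F.coordinates L ∧ L.Nodup ∧
        IsMinimalGeneratingSystem F.semigroup {g | g ∈ L} := by
  have hout : Primrec fun c : ℕ × ℕ × (ℕ × ℕ) × (ℕ × ℕ) × List (ℕ × ℕ) =>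
      (boxList c.2.1 c.2.2.1 c.2.2.2.1).filter (· ∈ c.2.2.2.2) :=
    primrecRel_mem_list.listFilter.comp
      (primrec_boxList (.comp .fst .snd) (.comp .fst (.comp .snd .snd))
        (.comp .fst (.comp .snd (.comp .snd .snd))))
      (.comp .snd (.comp .snd (.comp .snd .snd)))
  obtain ⟨A, hA⟩ := isSignDecidable_isCertificate.exists_realAlgorithm hout
  refine ⟨A, fun F hfg => ?_⟩
  obtain ⟨d, K, u, v, hF⟩ := F.exists_isLatticeFrame hfg
  obtain ⟨L, hL⟩ := hF.exists_isCertificate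
  obtain ⟨c, hc, hAc⟩ := hA F ⟨(d, K, u, v, L), hL⟩
  exact ⟨_, hAc, (nodup_boxList _ _ _).filter _, hc.isMinimalGeneratingSystem⟩

end ConvexPolygon

theorem mainTheorem1 :
    (∀ F : ConvexPolygon, ∃ τ₁ τ₂ : Submodule ℝ (ℝ × ℝ),
      τ₁ ≠ τ₂ ∧
      (∀ τ : Submodule ℝ (ℝ × ℝ),
        IsExtremalRay (rationalCone F.body) τ ↔ τ = τ₁ ∨ τ = τ₂) ∧
      (F.semigroup.FG ↔
        HasNonzeroRationalPoint (F.body ∩ τ₁) ∧ HasNonzeroRationalPoint (F.body ∩ τ₂))) ∧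
    (∃ A : RealAlgorithm (List (ℕ × ℕ)), ∀ F : ConvexPolygon, F.semigroup.FG →
      ∃ L : List (ℕ × ℕ), A.Outputs F.coordinates L ∧ L.Nodup ∧
        IsMinimalGeneratingSystem F.semigroup {g | g ∈ L}) := by
  refine ⟨fun F => ?_, ConvexPolygon.exists_realAlgorithm_isMinimalGeneratingSystem⟩
  obtain ⟨p, q, hpq⟩ := F.exists_isExtremalPair
  exact ⟨ℝ ∙ p, ℝ ∙ q, hpq.span_left_ne_span_right, hpq.isExtremalRay_iff, hpq.fg_iff⟩
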